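/- **Theorem (variance-reduced power method with momentum).** *Setting.* Let $d\ge 2$ and let $A\in\mathbb R^{d\times d}$ be symmetric positive semidefinite with eigenvalues $1\ge\lambda_1>\lambda_2\ge\dots\ge\lambda_d\ge 0$ and corresponding orthonormal eigenvectors $u_1,\dots,u_d$. Let $\tilde A_{k,t,i}$ $(k,t,i\ge 0)$ be i.i.d. random $d\times d$ matrices with $\mathbb E\tilde A_{k,t,i}=A$, $\|\tilde A_{k,t,i}\|\le r$ almost surely for some finite $r$, and $\mathbb E\|\tilde A_{k,t,i}-A\|^2=\sigma^2$ (spectral norm). *Algorithm (VR Power+M).* Inputs: a unit vector $w_0\in\mathbb R^d$, a momentum parameter $\beta\ge 0$, an epoch length $T\ge1$ and a batch size $s\ge 1$. Put $\tilde w_0=w_0$. For $k=0,1,2,\dots$, epoch $k$ computes $\tilde w_{k+1}$ from $\tilde w_k$ as follows. Start from $v_{-1}=0$, $v_0=\tilde w_k$. For $t=0,\dots,T-1$ set $$\alpha=v_t^T\tilde w_k,\qquad v_{t+1}=\frac1s\sum_{i=0}^{s-1}\tilde A_{k,t,i}\,(v_t-\alpha\tilde w_k)+\alpha A\tilde w_k-\beta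 v_{t-1},$$ and then replace the pair $(v_t,v_{t+1})$ by $(v_t,v_{t+1})/\|v_{t+1}\|$ (if $v_{t+1}=0$, both vectors are replaced by $0$, so that a breakdown counts as a failure). Finally put $\tilde w_{k+1}=v_T$. *Claim.* There are numerical constants $c_0\in(0,1/16)$ and $C>0$ such that for every $\epsilon\in(0,1)$ there is an integer $0\le K\le C\log(1/\epsilon)$, depending only on $\epsilon$, with the following property. Let $c\in(0,c_0]$ and $\delta\in(0,1)$, and let $d$, $A$ and the samples be as above. Suppose that $2\sqrt\beta\in[\lambda_2,\lambda_1)$, $\|w_0\|=1$, $1-(u_1^Tw_0)^2\le\frac12$, that $$T=\max\left\{1,\left\lceil\frac{\sqrt\beta}{\sqrt{\lambda_1^2-4\beta}}\log\frac1{c\delta}\right\rceil\right\},$$ and that $s\ge1$ is an integer with $$s\ \ge\ \frac{32\sqrt d\,\sqrt\beta\,\sigma^2}{c\,(\lambda_1^2-4\beta)^{3/2}\,\delta}\log\frac1{c\delta}.$$ Then after $K$ epochs, with probability at least $1-\log(1/\epsilon)\,\delta$, $$1-(u_1^T\tilde w_K)^2\le\epsilon .$$ In particular neither $T$ nor the required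 batch size depends on $\epsilon$. -/

import Mathlib

open MeasureTheory ProbabilityTheory

namespace VRPower

/-- `ℝ^d` with the Euclidean norm. -/
abbrev Vec (d : ℕ) := EuclideanSpace ℝ (Fin d)

/-- Real `d × d` matrices, viewed as operators on Euclidean `ℝ^d`; the norm is the spectral norm. -/
abbrev Op (d : ℕ) := Vec d →L[ℝ] Vec d

/-- `A` is symmetric positive semidefinite with eigenvalues `1 ≥ lam 0 > lam 1 ≥ ⋯ ≥ lam (d-1) ≥ 0`
(usually written `λ₁ > λ₂ ≥ ⋯`, counted from `0` here) and orthonormal eigenvectors `u 0, …, u (d-1)`. -/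
structure IsPCATarget {d : ℕ} (hd : 2 ≤ d) (A : Op d) (lam : Fin d → ℝ)
    (u : OrthonormalBasis (Fin d) ℝ (Vec d)) : Prop where
  eigen : ∀ i, A (u i) = lam i • u i
  antitone : Antitone lam
  nonneg : ∀ i, 0 ≤ lam i
  le_one : lam ⟨0, by omega⟩ ≤ 1
  gap : lam ⟨1, by omega⟩ < lam ⟨0, by omega⟩

/-- The samples `X k t i` (the `i`-th element of the mini-batch drawn at step `t` of epoch `k`) are
i.i.d. random matrices, almost surely bounded by `r`, with mean `A` and variance `σ²`. -/
structure IsIIDSamples {d : ℕ} {Ω : Type*} [MeasurableSpace Ω] (μ : Measure Ω)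
    (A : Op d) (r σ : ℝ) (X : ℕ → ℕ → ℕ → Ω → Op d) : Prop where
  measurable : ∀ k t i, Measurable (X k t i)
  indep : iIndepFun (fun j : ℕ × ℕ × ℕ => X j.1 j.2.1 j.2.2) μ
  identDistrib : ∀ k t i, IdentDistrib (X k t i) (X 0 0 0) μ μ
  bounded : ∀ᵐ ω ∂μ, ‖X 0 0 0 ω‖ ≤ r
  mean : ∫ ω, X 0 0 0 ω ∂μ = A
  variance : ∫ ω, ‖X 0 0 0 ω - A‖ ^ 2 ∂μ = σ ^ 2

/-- One inner step on the pair `p = (w_{t-1}, w_t)`, with anchor `a` and mini-batch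
`B 0, …, B (s-1)`: it returns `(w_t, w_{t+1})`, both divided by the norm of the new vector.
If the new vector is zero, both components become (and remain) zero. -/
noncomputable def step {d : ℕ} (A : Op d) (β : ℝ) (s : ℕ) (a : Vec d) (B : ℕ → Op d)
    (p : Vec d × Vec d) : Vec d × Vec d :=
  let α : ℝ := inner ℝ p.2 a
  let w : Vec d :=
    (1 / (s : ℝ)) • (∑ i ∈ Finset.range s, B i (p.2 - α • a)) + α • A a - β • p.1
  (‖w‖⁻¹ • p.2, ‖w‖⁻¹ • w)

/-- The pair `(w_{t-1}, w_t)` inside an epoch with anchor `a`; the epoch starts from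
`w_{-1} = 0`, `w_0 = a`, and its step `t` uses the mini-batch `B t`. -/
noncomputable def inner_loop {d : ℕ} (A : Op d) (β : ℝ) (s : ℕ) (a : Vec d)
    (B : ℕ → ℕ → Op d) : ℕ → Vec d × Vec d
  | 0 => (0, a)
  | t + 1 => step A β s a (B t) (inner_loop A β s a B t)

/-- The anchor after `k` epochs of length `T`, where `X k t i` are the sample matrices. -/
noncomputable def anchor {d : ℕ} (A : Op d) (β : ℝ) (s T : ℕ) (w₀ : Vec d)
    (X : ℕ → ℕ → ℕ → Op d) : ℕ → Vec d
  | 0 => w₀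
  | k + 1 => (inner_loop A β s (anchor A β s T w₀ X k) (X k) T).2

/-- The epoch length: the least positive integer that is at least
`√β / √(λ₁² - 4β) * log (1 / (c δ))`. -/
noncomputable def epochLength (lam₁ β c δ : ℝ) : ℕ :=
  max 1 ⌈√β / √(lam₁ ^ 2 - 4 * β) * Real.log (1 / (c * δ))⌉₊

/-- The lower bound on the batch size. -/
noncomputable def batchBound (d : ℕ) (lam₁ β σ c δ : ℝ) : ℝ :=
  32 * √(d : ℝ) * √β * σ ^ 2 / (c * (lam₁ ^ 2 - 4 * β) ^ (3 / 2 : ℝ) * δ)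
    * Real.log (1 / (c * δ))

end VRPower

/-!
# The variance-reduced power method with momentum

Within an epoch the normalisations only rescale, so the iterates are multiples of those of the
linear recurrence `v (t + 1) = A v t - β v (t - 1) + n t` (`rawLoop`, `inner_loop_eq`), as long as no
iterate vanishes. The noise `n t` is the averaged deviation of the mini-batch from `A`, applied to
the component of `v t` orthogonal to the anchor.

In the coordinate along `u i` the noiseless recurrence is solved by the rescaled Chebyshev
polynomial `momentumPoly β (lam i)`. For the leading eigenvalue the characteristic roots
`r > v ≥ 0` are real, and the solution `P t` grows at least like `r ^ t`. For every other eigenvalue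
`lam i ≤ 2 * √β`, so the solution is at most `(t + 1) * √β ^ t`. The estimate
`sub_mul_pow_le_momentumPoly` shows that the epoch length makes the ratio of the two small; this is
the contraction.

The noise terms are pairwise uncorrelated, hence their variances add up
(`IsEpoch.integral_sq_sum_noise`). If the anchor has error `Θ`, the component orthogonal to it stays
of mean square at most `16 * Θ * P t ^ 2` (`le_of_moment_recursion`), so that the noise itself is
proportional to `Θ`: this is the variance reduction. The recursion closes because noise entering at
time `j` and propagated to time `t` loses the gap `r - v` (`momentumPoly_mul_le`), and because the
first step of an epoch has no noise, so that an epoch with `T` steps has only `T - 1` noisy ones.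

The leading coordinate must stay away from zero during the whole epoch, since a vanishing iterate is
a breakdown. The combination `x (t + 1) - v * x t`, divided by `r ^ (t + 1)`, is a martingale, and a
maximal inequality for it (`IsEpoch.measureReal_walk_le`) bounds `|x t|` below by `P t / 2` for all
`t` at once (`half_momentumPoly_le_abs`). Markov's inequality controls the noise in the other
coordinates at the end of the epoch. Together, an epoch halves the error except with probability
`δ / 2` (`IsEpoch.measureReal_bad_le`), and a union bound over about `log₂ (1 / ε)` epochs concludes.
-/

namespace VRPower

/-! ### The scalar momentum recurrence -/

/-- The polynomials in `l` that solve the scalar momentum recurrence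
`x (t + 2) = l * x (t + 1) - β * x t` with `x 0 = 1`, `x 1 = l`: Chebyshev polynomials of the second
kind, rescaled so that the oscillating regime is `|l| ≤ 2 * √β`. -/
def momentumPoly (β l : ℝ) : ℕ → ℝ
  | 0 => 1
  | 1 => l
  | t + 2 => l * momentumPoly β l (t + 1) - β * momentumPoly β l t

/-- One root of the characteristic polynomial reduces the recurrence to first order, the other one
being the source term. Stated in an algebra over `ℝ`, so that it covers real and complex roots. -/
theorem algebraMap_momentumPoly_succ {R : Type*} [CommRing R] [Algebra ℝ R] {β l : ℝ} {z w : R}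
    (hl : algebraMap ℝ R l = z + w) (hβ : algebraMap ℝ R β = z * w) (t : ℕ) :
    algebraMap ℝ R (momentumPoly β l (t + 1)) =
      z * algebraMap ℝ R (momentumPoly β l t) + w ^ (t + 1) := by
  induction t with
  | zero => simp [momentumPoly, hl]
  | succ t ih =>
    rw [show momentumPoly β l (t + 1 + 1)
      = l * momentumPoly β l (t + 1) - β * momentumPoly β l t from rfl]
    rw [map_sub, map_mul, map_mul, hl, hβ, ih]
    ring

theorem momentumPoly_succ {β l z w : ℝ} (hl : l = z + w) (hβ : β = z * w) (t : ℕ) :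
    momentumPoly β l (t + 1) = z * momentumPoly β l t + w ^ (t + 1) := by
  simpa using algebraMap_momentumPoly_succ (R := ℝ) (by simpa using hl) (by simpa using hβ) t

/-- In the oscillating regime both characteristic roots have modulus `√β`. -/
theorem abs_momentumPoly_le {β l : ℝ} (hβ : 0 ≤ β) (hl0 : 0 ≤ l) (hl : l ≤ 2 * √β) (t : ℕ) :
    |momentumPoly β l t| ≤ (t + 1) * √β ^ t := by
  have hb := Real.sq_sqrt hβ
  have hD : 0 ≤ β - (l / 2) ^ 2 := by nlinarith [Real.sqrt_nonneg β]
  have hq := Real.sq_sqrt hD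
  set q := √(β - (l / 2) ^ 2) with hqdef
  set z : ℂ := ⟨l / 2, q⟩ with hz
  set w : ℂ := ⟨l / 2, -q⟩ with hw
  have hzl : algebraMap ℝ ℂ l = z + w := by
    apply Complex.ext <;> simp [hz, hw]
  have hzb : algebraMap ℝ ℂ β = z * w := by
    apply Complex.ext
    · simp [hz, hw]; nlinarith
    · simp [hz, hw]; ring
  have hnz : ‖z‖ = √β := by
    rw [Complex.norm_def, Complex.normSq_apply]; congr 1; simp [hz]; nlinarith
  have hnw : ‖w‖ = √β := by
    rw [Complex.norm_def, Complex.normSq_apply]; congr 1; simp [hw]; nlinarith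
  have key : ∀ t : ℕ, ‖algebraMap ℝ ℂ (momentumPoly β l t)‖ ≤ (t + 1) * √β ^ t := by
    intro t
    induction t with
    | zero => simp [momentumPoly]
    | succ t ih =>
      rw [algebraMap_momentumPoly_succ hzl hzb]
      calc _ ≤ ‖z * algebraMap ℝ ℂ (momentumPoly β l t)‖ + ‖w ^ (t + 1)‖ := norm_add_le _ _
        _ ≤ √β * ((t + 1) * √β ^ t) + √β ^ (t + 1) := by
            rw [norm_mul, norm_pow, hnz, hnw]
            gcongr
        _ = _ := by push_cast; ring
  simpa using key t

section RealRoots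

variable {r w : ℝ}

theorem sub_mul_momentumPoly (r w : ℝ) (t : ℕ) :
    (r - w) * momentumPoly (r * w) (r + w) t = r ^ (t + 1) - w ^ (t + 1) := by
  induction t with
  | zero => simp [momentumPoly]
  | succ t ih =>
    rw [momentumPoly_succ (β := r * w) (l := r + w) rfl rfl]
    linear_combination r * ih

theorem pow_le_momentumPoly (hw : 0 ≤ w) (hr : w ≤ r) (t : ℕ) :
    r ^ t ≤ momentumPoly (r * w) (r + w) t := by
  have hr0 := hw.trans hr
  induction t with
  | zero => simp [momentumPoly]
  | succ t ih =>
    rw [momentumPoly_succ (β := r * w) (l := r + w) rfl rfl]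
    have : 0 ≤ w ^ (t + 1) := by positivity
    have := mul_le_mul_of_nonneg_left ih hr0
    rw [pow_succ']; linarith

theorem momentumPoly_pos (hw : 0 ≤ w) (hr : w < r) (t : ℕ) :
    0 < momentumPoly (r * w) (r + w) t :=
  lt_of_lt_of_le (pow_pos (hw.trans_lt hr) t) (pow_le_momentumPoly hw hr.le t)

theorem sub_mul_momentumPoly_le (hw : 0 ≤ w) (t : ℕ) :
    (r - w) * momentumPoly (r * w) (r + w) t ≤ r ^ (t + 1) := by
  rw [sub_mul_momentumPoly]
  have : 0 ≤ w ^ (t + 1) := by positivity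
  linarith

/-- Noise that enters at time `j` and is then propagated for `i` further steps costs only
the factor `(r - w)⁻¹` against the growth of the signal over the whole time. -/
theorem momentumPoly_mul_le (hw : 0 ≤ w) (hr : w < r) (i j : ℕ) :
    (r - w) * (momentumPoly (r * w) (r + w) i * momentumPoly (r * w) (r + w) j) ≤
      momentumPoly (r * w) (r + w) (i + j + 1) := by
  have h : 0 < r - w := sub_pos.2 hr
  refine le_of_mul_le_mul_left ?_ h
  rw [sub_mul_momentumPoly r w (i + j + 1)]
  have e : (r - w) * ((r - w) *
      (momentumPoly (r * w) (r + w) i * momentumPoly (r * w) (r + w) j)) =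
      (r ^ (i + 1) - w ^ (i + 1)) * (r ^ (j + 1) - w ^ (j + 1)) := by
    rw [← sub_mul_momentumPoly, ← sub_mul_momentumPoly]; ring
  rw [e]
  have h1 : w ^ (i + 1) ≤ r ^ (i + 1) := by gcongr
  have h2 : w ^ (j + 1) ≤ r ^ (j + 1) := by gcongr
  have h3 : 0 ≤ w ^ (i + 1) := by positivity
  have h4 : 0 ≤ w ^ (j + 1) := by positivity
  have e1 : r ^ (i + j + 1 + 1) = r ^ (i + 1) * r ^ (j + 1) := by ring
  have e2 : w ^ (i + j + 1 + 1) = w ^ (i + 1) * w ^ (j + 1) := by ring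
  rw [e1, e2]
  nlinarith [mul_le_mul_of_nonneg_right h1 h4, mul_le_mul_of_nonneg_left h2 h3]

variable {b : ℝ}

theorem momentumPoly_add_two (r w : ℝ) (t : ℕ) :
    momentumPoly (r * w) (r + w) (t + 2) =
      r * w * momentumPoly (r * w) (r + w) t + (r ^ (t + 2) + w ^ (t + 2)) := by
  have h1 := momentumPoly_succ (β := r * w) (l := r + w) rfl rfl (t + 1)
  have h2 := momentumPoly_succ (β := r * w) (l := r + w) (add_comm _ _) (mul_comm _ _) t
  rw [h2] at h1
  rw [h1]
  ring

theorem succ_mul_pow_le_momentumPoly (hw : 0 ≤ w) (hr : w ≤ r) (hb : b ^ 2 = r * w)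
    (t : ℕ) : (t + 1) * b ^ t ≤ momentumPoly (r * w) (r + w) t := by
  have hr0 := hw.trans hr
  induction t using Nat.twoStepInduction with
  | zero => simp [momentumPoly]
  | one => simp [momentumPoly]; nlinarith [sq_nonneg (r - w)]
  | more t ih _ =>
    rw [momentumPoly_add_two]
    have h1 : 2 * b ^ (t + 2) ≤ r ^ (t + 2) + w ^ (t + 2) := by
      refine le_of_sq_le_sq ?_ (by positivity)
      have e : (b ^ (t + 2)) ^ 2 = r ^ (t + 2) * w ^ (t + 2) := by
        rw [← pow_mul, mul_comm, pow_mul, hb, mul_pow]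
      nlinarith [sq_nonneg (r ^ (t + 2) - w ^ (t + 2))]
    have h2 := mul_le_mul_of_nonneg_left ih (by positivity : 0 ≤ r * w)
    have e : r * w * ((t + 1) * b ^ t) = (t + 1) * b ^ (t + 2) := by rw [← hb]; ring
    rw [e] at h2
    push_cast
    linarith

/-- A quadratic gain over the oscillating regime. It is uniform in the roots, hence covers both long
epochs with a small gap and short epochs with a large gap. -/
theorem sub_mul_pow_le_momentumPoly (hw : 0 ≤ w) (hr : w ≤ r) (hb : b ^ 2 = r * w)
    (t : ℕ) :
    (r - w) * ((t + 1) * (t + 3)) * b ^ t ≤ 4 * momentumPoly (r * w) (r + w) (t + 1) := by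
  have hr0 := hw.trans hr
  -- `r ^ m + w ^ m` already gains `m * (r - w)` over `b ^ (m - 1)`
  have hpow : ∀ m : ℕ, (r - w) * ((m + 1) * b ^ m) ≤ r ^ (m + 1) + w ^ (m + 1) := by
    intro m
    have h1 := mul_le_mul_of_nonneg_left (succ_mul_pow_le_momentumPoly hw hr hb m)
      (sub_nonneg.2 hr)
    rw [sub_mul_momentumPoly] at h1
    have : 0 ≤ w ^ (m + 1) := by positivity
    linarith
  induction t using Nat.twoStepInduction with
  | zero => simp [momentumPoly]; linarith
  | one =>
    have h := hpow 1
    rw [show (1 : ℕ) + 1 = 0 + 2 from rfl, momentumPoly_add_two]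
    have : 0 ≤ r * w * momentumPoly (r * w) (r + w) 0 := by
      simp [momentumPoly]; positivity
    norm_num at h ⊢
    nlinarith
  | more t ih _ =>
    have h := hpow (t + 2)
    rw [show t + 2 + 1 = t + 1 + 2 from rfl, momentumPoly_add_two]
    have h2 := mul_le_mul_of_nonneg_left ih (by positivity : 0 ≤ r * w)
    rw [show (r ^ (t + 2 + 1) + w ^ (t + 2 + 1)) = r ^ (t + 1 + 2) + w ^ (t + 1 + 2) from rfl] at h
    have e : r * w * ((r - w) * ((t + 1) * (t + 3)) * b ^ t) =
        (r - w) * ((t + 1) * (t + 3)) * b ^ (t + 2) := by rw [← hb]; ring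
    rw [e] at h2
    push_cast at h ⊢
    linarith

end RealRoots

/-! ### The recurrence with a source term -/

/-- Variation of constants for the noisy momentum recurrence. -/
theorem eq_momentumPoly_mul_add_sum {β l : ℝ} {x n : ℕ → ℝ} (h1 : x 1 = l * x 0 + n 0)
    (h2 : ∀ t, x (t + 2) = l * x (t + 1) - β * x t + n (t + 1)) (t : ℕ) :
    x t = momentumPoly β l t * x 0 +
      ∑ j ∈ Finset.range t, momentumPoly β l (t - 1 - j) * n j := by
  induction t using Nat.twoStepInduction with
  | zero => simp [momentumPoly]
  | one => simp [momentumPoly, h1]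
  | more t ih ih' =>
    rw [h2, ih, ih']
    rw [Finset.sum_range_succ _ (t + 1), Finset.sum_range_succ _ t, Finset.sum_range_succ _ t]
    have e : ∀ j ∈ Finset.range t, momentumPoly β l (t + 2 - 1 - j) * n j =
        l * (momentumPoly β l (t + 1 - 1 - j) * n j) - β * (momentumPoly β l (t - 1 - j) * n j) := by
      intro j hj
      have hj := Finset.mem_range.1 hj
      obtain ⟨m, rfl⟩ : ∃ m, t = j + 1 + m := ⟨t - (j + 1), by omega⟩
      rw [show j + 1 + m + 2 - 1 - j = m + 2 by omega, show j + 1 + m + 1 - 1 - j = m + 1 by omega,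
        show j + 1 + m - 1 - j = m by omega, momentumPoly]
      ring
    rw [Finset.sum_congr rfl e, Finset.sum_sub_distrib, ← Finset.mul_sum, ← Finset.mul_sum,
      show t + 2 - 1 - (t + 1) = 0 by omega, show t + 2 - 1 - t = 1 by omega,
      show t + 1 - 1 - t = 0 by omega]
    simp only [momentumPoly]
    ring

section LowerBound

variable {r w m : ℝ} {x n : ℕ → ℝ}

/-- `x (t + 1) - w * x t`, divided by `r ^ (t + 1)`, only accumulates the noise; therefore a lower
bound on the accumulated noise propagates to `x`. -/
theorem mul_momentumPoly_le_of_le (hw : 0 ≤ w) (hr : 0 < r) (h1 : x 1 = (r + w) * x 0 + n 0)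
    (h2 : ∀ t, x (t + 2) = (r + w) * x (t + 1) - r * w * x t + n (t + 1)) {T : ℕ}
    (hm : ∀ t ≤ T, m ≤ x 0 + ∑ j ∈ Finset.range t, n j / r ^ (j + 1)) {t : ℕ} (ht : t ≤ T) :
    m * momentumPoly (r * w) (r + w) t ≤ x t := by
  have hz : ∀ t, x (t + 1) - w * x t =
      r ^ (t + 1) * (x 0 + ∑ j ∈ Finset.range (t + 1), n j / r ^ (j + 1)) := by
    intro t
    induction t with
    | zero => simp [h1]; field_simp; ring
    | succ t ih =>
      have hp : r ^ (t + 1 + 1) ≠ 0 := by positivity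
      rw [h2, Finset.sum_range_succ _ (t + 1), ← add_assoc, mul_add,
        mul_div_cancel₀ _ hp, pow_succ' r (t + 1), mul_assoc r (r ^ (t + 1)), ← ih]
      ring
  induction t with
  | zero => simpa [momentumPoly] using hm 0 (Nat.zero_le _)
  | succ t ih =>
    have e : momentumPoly (r * w) (r + w) (t + 1) =
        w * momentumPoly (r * w) (r + w) t + r ^ (t + 1) :=
      momentumPoly_succ (add_comm _ _) (mul_comm _ _) t
    have h3 := mul_le_mul_of_nonneg_left (hm (t + 1) ht) (by positivity : 0 ≤ r ^ (t + 1))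
    have h4 := mul_le_mul_of_nonneg_left (ih (by omega)) hw
    rw [e]
    linarith [hz t]

/-- With `|x 0| ≥ 1 / √2` and accumulated noise at most `1 / 5`, at least half of the noiseless signal
survives: `1 / √2 - 1 / 5 > 1 / 2`. -/
theorem half_momentumPoly_le_abs (hw : 0 ≤ w) (hr : 0 < r) (h1 : x 1 = (r + w) * x 0 + n 0)
    (h2 : ∀ t, x (t + 2) = (r + w) * x (t + 1) - r * w * x t + n (t + 1)) {T : ℕ}
    (h0 : 1 / 2 ≤ x 0 ^ 2)
    (hm : ∀ t ≤ T, |∑ j ∈ Finset.range t, n j / r ^ (j + 1)| ≤ 1 / 5) {t : ℕ} (ht : t ≤ T) :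
    1 / 2 * momentumPoly (r * w) (r + w) t ≤ |x t| := by
  rcases le_total 0 (x 0) with hx | hx
  · refine le_trans (mul_momentumPoly_le_of_le hw hr h1 h2 (fun t ht => ?_) ht) (le_abs_self _)
    have := (abs_le.1 (hm t ht)).1
    nlinarith
  · refine le_trans (mul_momentumPoly_le_of_le (x := fun t => - x t) (n := fun t => - n t)
      hw hr (by simp only [h1]; ring) (fun t => by simp only [h2]; ring) (fun t ht => ?_) ht)
      (neg_le_abs _)
    have := (abs_le.1 (hm t ht)).2
    have e : ∑ j ∈ Finset.range t, -n j / r ^ (j + 1) = -∑ j ∈ Finset.range t, n j / r ^ (j + 1) := by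
      rw [← Finset.sum_neg_distrib]; exact Finset.sum_congr rfl fun j _ => by ring
    simp only [e]
    nlinarith

end LowerBound

/-! ### Essentially bounded adapted variables -/

section Bounded

variable {Ω : Type*} {m m' m0 : MeasurableSpace Ω} {μ : Measure[m0] Ω}
  {E F G : Type*} [NormedAddCommGroup E] [NormedAddCommGroup F] [NormedAddCommGroup G]

/-- `f` is measurable with respect to the sub-σ-algebra `m` and `μ`-essentially bounded. -/
structure BddMeas (μ : Measure[m0] Ω) (m : MeasurableSpace Ω) (f : Ω → E) : Prop where
  meas : StronglyMeasurable[m] f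
  bdd : ∃ C : ℝ, ∀ᵐ ω ∂μ, ‖f ω‖ ≤ C

namespace BddMeas

theorem mono {f : Ω → E} (hf : BddMeas μ m f) (h : m ≤ m') : BddMeas μ m' f :=
  ⟨hf.meas.mono h, hf.bdd⟩

theorem const (x : E) : BddMeas μ m fun _ => x :=
  ⟨stronglyMeasurable_const, ‖x‖, by simp⟩

/-- Closed balls of a proper space are compact, so bounded variables are preserved by all
continuous operations. -/
theorem comp₂ [ProperSpace E] [ProperSpace F] {f : Ω → E} {g : Ω → F} (hf : BddMeas μ m f)
    (hg : BddMeas μ m g) {φ : E × F → G} (hφ : Continuous φ) :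
    BddMeas μ m fun ω => φ (f ω, g ω) := by
  refine ⟨hφ.comp_stronglyMeasurable (hf.meas.prodMk hg.meas), ?_⟩
  obtain ⟨C, hC⟩ := hf.bdd
  obtain ⟨D, hD⟩ := hg.bdd
  obtain ⟨M, hM⟩ := ((isCompact_closedBall (0 : E) C).prod
    (isCompact_closedBall (0 : F) D)).exists_bound_of_continuousOn hφ.continuousOn
  refine ⟨M, ?_⟩
  filter_upwards [hC, hD] with ω h1 h2
  exact hM _ ⟨by simpa using h1, by simpa using h2⟩

theorem comp [ProperSpace E] {f : Ω → E} (hf : BddMeas μ m f) {φ : E → F} (hφ : Continuous φ) :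
    BddMeas μ m fun ω => φ (f ω) :=
  hf.comp₂ (const (0 : ℝ)) (φ := fun p => φ p.1) (by fun_prop)

theorem add [ProperSpace E] {f g : Ω → E} (hf : BddMeas μ m f) (hg : BddMeas μ m g) :
    BddMeas μ m fun ω => f ω + g ω :=
  hf.comp₂ hg (φ := fun p => p.1 + p.2) (by fun_prop)

theorem sub [ProperSpace E] {f g : Ω → E} (hf : BddMeas μ m f) (hg : BddMeas μ m g) :
    BddMeas μ m fun ω => f ω - g ω :=
  hf.comp₂ hg (φ := fun p => p.1 - p.2) (by fun_prop)

theorem mul {f g : Ω → ℝ} (hf : BddMeas μ m f) (hg : BddMeas μ m g) :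
    BddMeas μ m fun ω => f ω * g ω :=
  hf.comp₂ hg (φ := fun p => p.1 * p.2) (by fun_prop)

theorem smul [NormedSpace ℝ E] [ProperSpace E] {f : Ω → ℝ} {g : Ω → E} (hf : BddMeas μ m f)
    (hg : BddMeas μ m g) : BddMeas μ m fun ω => f ω • g ω :=
  hf.comp₂ hg (φ := fun p => p.1 • p.2) (by fun_prop)

theorem finset_sum [ProperSpace E] {ι : Type*} {f : ι → Ω → E} {S : Finset ι}
    (hf : ∀ i ∈ S, BddMeas μ m (f i)) : BddMeas μ m fun ω => ∑ i ∈ S, f i ω := by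
  classical
  induction S using Finset.induction_on with
  | empty => simpa using const (0 : E)
  | insert i S hi ih =>
    simp only [Finset.sum_insert hi]
    exact (hf i (Finset.mem_insert_self i S)).add
      (ih fun j hj => hf j (Finset.mem_insert_of_mem hj))

theorem sum [ProperSpace E] {f : ℕ → Ω → E} {n : ℕ} (hf : ∀ i < n, BddMeas μ m (f i)) :
    BddMeas μ m fun ω => ∑ i ∈ Finset.range n, f i ω :=
  finset_sum fun i hi => hf i (Finset.mem_range.1 hi)

theorem integrable [IsProbabilityMeasure μ] {f : Ω → E} (hf : BddMeas μ m f) (hm : m ≤ m0) :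
    Integrable f μ := by
  obtain ⟨C, hC⟩ := hf.bdd
  exact Integrable.of_bound (hf.meas.mono hm).aestronglyMeasurable C hC

theorem apply {d : ℕ} {D : Ω → Op d} {f : Ω → Vec d} (hD : BddMeas μ m D) (hf : BddMeas μ m f) :
    BddMeas μ m fun ω => D ω (f ω) :=
  hD.comp₂ hf (φ := fun p => p.1 p.2) (by fun_prop)

theorem inner {d : ℕ} {f g : Ω → Vec d} (hf : BddMeas μ m f) (hg : BddMeas μ m g) :
    BddMeas μ m fun ω => inner ℝ (f ω) (g ω) :=
  hf.comp₂ hg (φ := fun p => Inner.inner ℝ p.1 p.2) (by fun_prop)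

theorem norm_sq [ProperSpace E] {f : Ω → E} (hf : BddMeas μ m f) :
    BddMeas μ m fun ω => ‖f ω‖ ^ 2 :=
  hf.comp (φ := fun x => ‖x‖ ^ 2) (by fun_prop)

end BddMeas

/-! ### Noise that is independent of the past -/

variable [IsProbabilityMeasure μ]

/-- Applying an independent centred random matrix gives a vector that is uncorrelated with the
past: the functional `L ↦ ⟪G, L F⟫` is independent of `D`. -/
theorem integral_inner_apply_eq_zero {d : ℕ} {D : Ω → Op d} {U V : Ω → Vec d} (hm : m ≤ m0)
    (hD : BddMeas μ m0 D) (hind : Indep (MeasurableSpace.comap D inferInstance) m μ)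
    (hmean : ∫ ω, D ω ∂μ = 0) (hU : BddMeas μ m U) (hV : BddMeas μ m V) :
    ∫ ω, inner ℝ (U ω) (D ω (V ω)) ∂μ = 0 := by
  set Z : Ω → (Op d →L[ℝ] ℝ) := fun ω =>
    (innerSL ℝ (U ω)).comp (ContinuousLinearMap.apply ℝ (Vec d) (V ω)) with hZ
  have hZm : BddMeas μ m Z :=
    hU.comp₂ hV (φ := fun p => (innerSL ℝ p.1).comp (ContinuousLinearMap.apply ℝ (Vec d) p.2))
      (by fun_prop)
  have hI : IndepFun D Z μ := by
    rw [IndepFun_iff_Indep]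
    exact indep_of_indep_of_le_right hind hZm.meas.measurable.comap_le
  have h := hI.symm.integral_bilin (hZm.integrable hm) (hD.integrable le_rfl)
    (ContinuousLinearMap.id ℝ (Op d →L[ℝ] ℝ))
  rw [hmean, map_zero] at h
  exact h

/-- An independent matrix acts on the past with its mean squared operator norm. -/
theorem integral_norm_sq_apply_le {d : ℕ} {D : Ω → Op d} {V : Ω → Vec d} {v : ℝ} (hm : m ≤ m0)
    (hD : BddMeas μ m0 D) (hind : Indep (MeasurableSpace.comap D inferInstance) m μ)
    (hvar : ∫ ω, ‖D ω‖ ^ 2 ∂μ = v) (hV : BddMeas μ m V) :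
    ∫ ω, ‖D ω (V ω)‖ ^ 2 ∂μ ≤ v * ∫ ω, ‖V ω‖ ^ 2 ∂μ := by
  have hI : IndepFun (fun ω => ‖D ω‖ ^ 2) (fun ω => ‖V ω‖ ^ 2) μ := by
    have : IndepFun D V μ := by
      rw [IndepFun_iff_Indep]
      exact indep_of_indep_of_le_right hind hV.meas.measurable.comap_le
    exact this.comp (φ := fun x => ‖x‖ ^ 2) (ψ := fun x => ‖x‖ ^ 2) (by fun_prop) (by fun_prop)
  have hDi := hD.norm_sq
  have hVi := hV.norm_sq.mono hm
  rw [← hvar, ← hI.integral_fun_mul_eq_mul_integral (hDi.integrable le_rfl).aestronglyMeasurable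
    (hVi.integrable le_rfl).aestronglyMeasurable]
  refine integral_mono ((hD.apply (hV.mono hm)).norm_sq.integrable le_rfl)
    ((hDi.mul hVi).integrable le_rfl) fun ω => ?_
  simp only
  rw [← mul_pow]
  gcongr
  exact (D ω).le_opNorm _

/-- Pythagoras for pairwise uncorrelated vectors. -/
theorem integral_norm_sq_sum_eq {E : Type*} [NormedAddCommGroup E] [InnerProductSpace ℝ E]
    [ProperSpace E] {f : ℕ → Ω → E} {n : ℕ} (hf : ∀ i < n, BddMeas μ m0 (f i))
    (horth : ∀ i j, i < j → j < n → ∫ ω, inner ℝ (f i ω) (f j ω) ∂μ = 0) :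
    ∫ ω, ‖∑ i ∈ Finset.range n, f i ω‖ ^ 2 ∂μ = ∑ i ∈ Finset.range n, ∫ ω, ‖f i ω‖ ^ 2 ∂μ := by
  induction n with
  | zero => simp
  | succ n ih =>
    have hS : BddMeas μ m0 fun ω => ∑ i ∈ Finset.range n, f i ω :=
      BddMeas.sum fun i hi => hf i (by omega)
    have hn := hf n (by omega)
    have hin : ∀ {g h : Ω → E}, BddMeas μ m0 g → BddMeas μ m0 h →
        Integrable (fun ω => inner ℝ (g ω) (h ω)) μ := fun hg hh =>
      (hg.comp₂ hh (φ := fun p => inner ℝ p.1 p.2) (by fun_prop)).integrable le_rfl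
    have hcross : ∫ ω, inner ℝ (∑ i ∈ Finset.range n, f i ω) (f n ω) ∂μ = 0 := by
      simp only [sum_inner]
      rw [integral_finsetSum _ fun i hi => hin (hf i (by have := Finset.mem_range.1 hi; omega)) hn]
      exact Finset.sum_eq_zero fun i hi => horth i n (Finset.mem_range.1 hi) (by omega)
    simp only [Finset.sum_range_succ, norm_add_sq_real]
    rw [integral_add, integral_add, integral_const_mul, hcross,
      ih (fun i hi => hf i (by omega)) fun i j h1 h2 => horth i j h1 (by omega)]
    · ring
    · exact hS.norm_sq.integrable le_rfl
    · exact (hin hS hn).const_mul 2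
    · exact (hS.norm_sq.integrable le_rfl).add ((hin hS hn).const_mul 2)
    · exact hn.norm_sq.integrable le_rfl

/-- Markov's inequality with a strict inequality in the event. -/
theorem measureReal_lt_le {f : Ω → ℝ} {a κ : ℝ} (hf : Integrable f μ) (h0 : ∀ ω, 0 ≤ f ω)
    (ha : 0 < a) (h : ∫ ω, f ω ∂μ ≤ κ * a) : μ.real {ω | a < f ω} ≤ κ := by
  have h1 := mul_meas_ge_le_integral_of_nonneg (ae_of_all _ h0) hf a
  have h2 : μ.real {ω | a < f ω} ≤ μ.real {ω | a ≤ f ω} :=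
    measureReal_mono (fun ω (hω : a < f ω) => hω.le)
  nlinarith

end Bounded

/-! ### The unnormalised inner loop -/

section Loop

variable {d : ℕ}

/-- The inner loop without the normalisation: the pair `(v (t - 1), v t)`, started at `(0, a)`. -/
noncomputable def rawLoop (A : Op d) (β : ℝ) (s : ℕ) (a : Vec d) (B : ℕ → ℕ → Op d) :
    ℕ → Vec d × Vec d
  | 0 => (0, a)
  | t + 1 =>
    ((rawLoop A β s a B t).2,
      (1 / (s : ℝ)) • (∑ i ∈ Finset.range s, B t i ((rawLoop A β s a B t).2 -
          (inner ℝ (rawLoop A β s a B t).2 a : ℝ) • a)) +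
        (inner ℝ (rawLoop A β s a B t).2 a : ℝ) • A a - β • (rawLoop A β s a B t).1)

/-- The component of the iterate orthogonal to the anchor, which is what the random matrices see. -/
noncomputable def residual (A : Op d) (β : ℝ) (s : ℕ) (a : Vec d) (B : ℕ → ℕ → Op d) (t : ℕ) :
    Vec d :=
  (rawLoop A β s a B t).2 - (inner ℝ (rawLoop A β s a B t).2 a : ℝ) • a

/-- The deviation of the unnormalised step from the exact momentum step with `A`. -/
noncomputable def noise (A : Op d) (β : ℝ) (s : ℕ) (a : Vec d) (B : ℕ → ℕ → Op d) (t : ℕ) :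
    Vec d :=
  (1 / (s : ℝ)) • ∑ i ∈ Finset.range s, (B t i - A) (residual A β s a B t)

variable {A : Op d} {β : ℝ} {s : ℕ} {a : Vec d} {B : ℕ → ℕ → Op d}

theorem rawLoop_succ_snd (hs : 1 ≤ s) (t : ℕ) :
    (rawLoop A β s a B (t + 1)).2 = A (rawLoop A β s a B t).2 - β • (rawLoop A β s a B t).1 +
      noise A β s a B t := by
  have hs' : (s : ℝ) ≠ 0 := by positivity
  simp only [rawLoop, noise, residual, sub_apply, Finset.sum_sub_distrib, Finset.sum_const,
    Finset.card_range, smul_sub, map_sub, map_smul]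
  rw [← Nat.cast_smul_eq_nsmul ℝ, ← Nat.cast_smul_eq_nsmul ℝ, smul_smul, smul_smul,
    one_div_mul_cancel hs']
  module

/-- As long as no iterate vanishes, normalising in every step amounts to normalising once. -/
theorem inner_loop_eq (ha : ‖a‖ = 1) {t : ℕ} (h : ∀ j ≤ t, (rawLoop A β s a B j).2 ≠ 0) :
    inner_loop A β s a B t = ‖(rawLoop A β s a B t).2‖⁻¹ • rawLoop A β s a B t := by
  induction t with
  | zero => simp [inner_loop, rawLoop, ha]
  | succ t ih =>
    have hp : 0 < ‖(rawLoop A β s a B t).2‖⁻¹ := inv_pos.2 (norm_pos_iff.2 (h t (by omega)))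
    rw [inner_loop, ih fun j hj => h j (by omega)]
    set p := rawLoop A β s a B t with hpdef
    set c := ‖p.2‖⁻¹
    have e : (1 / (s : ℝ)) • (∑ i ∈ Finset.range s, B t i ((c • p).2 -
          (inner ℝ (c • p).2 a : ℝ) • a)) +
        (inner ℝ (c • p).2 a : ℝ) • A a - β • (c • p).1 =
        c • (rawLoop A β s a B (t + 1)).2 := by
      simp only [rawLoop, ← hpdef, Prod.smul_snd, Prod.smul_fst, inner_smul_left, mul_smul]
      simp only [conj_trivial, ← smul_sub, map_smul, ← Finset.smul_sum]
      module
    have e1 : (rawLoop A β s a B (t + 1)).1 = p.2 := rfl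
    simp only [step]
    rw [e, norm_smul, Real.norm_of_nonneg hp.le]
    refine Prod.ext ?_ ?_
    · simp only [Prod.smul_snd, Prod.smul_fst, smul_smul, e1]
      congr 1
      field_simp
    · simp only [Prod.smul_snd, smul_smul]
      congr 1
      field_simp

variable {hd : 2 ≤ d} {lam : Fin d → ℝ} {u : OrthonormalBasis (Fin d) ℝ (Vec d)}

theorem IsPCATarget.inner_apply (h : IsPCATarget hd A lam u) (i : Fin d) (v : Vec d) :
    inner ℝ (u i) (A v) = lam i * inner ℝ (u i) v := by
  conv_lhs => rw [← u.sum_repr' v, map_sum, inner_sum]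
  rw [Finset.sum_eq_single i]
  · rw [map_smul, h.eigen, inner_smul_right, inner_smul_right]
    simp [mul_comm]
  · intro j _ hj
    rw [map_smul, h.eigen, inner_smul_right, inner_smul_right, u.inner_eq_zero (Ne.symm hj)]
    simp
  · simp

/-- The coordinate of the `t`-th iterate along an eigenvector. -/
theorem inner_rawLoop_eq (h : IsPCATarget hd A lam u) (hs : 1 ≤ s) (i : Fin d) (t : ℕ) :
    inner ℝ (u i) (rawLoop A β s a B t).2 = momentumPoly β (lam i) t * inner ℝ (u i) a +
      ∑ j ∈ Finset.range t,
        momentumPoly β (lam i) (t - 1 - j) * inner ℝ (u i) (noise A β s a B j) := by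
  refine eq_momentumPoly_mul_add_sum (β := β) (l := lam i)
    (x := fun t => inner ℝ (u i) (rawLoop A β s a B t).2)
    (n := fun t => inner ℝ (u i) (noise A β s a B t)) ?_ ?_ t
  · rw [rawLoop_succ_snd hs, inner_add_right, inner_sub_right, h.inner_apply]
    simp [rawLoop]
  · intro t
    rw [rawLoop_succ_snd hs, inner_add_right, inner_sub_right, h.inner_apply, inner_smul_right]
    rfl

theorem sum_inner_sq (u : OrthonormalBasis (Fin d) ℝ (Vec d)) (v : Vec d) :
    ∑ i, (inner ℝ (u i) v : ℝ) ^ 2 = ‖v‖ ^ 2 := by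
  rw [← u.sum_sq_norm_inner_right v]
  simp

/-- Split `v` along a basis vector `u i₀`: if the anchor nearly equals `u i₀`, then that component
of `v` is almost removed by the projection, and the rest is not enlarged. -/
theorem norm_sub_inner_smul_sq_le (u : OrthonormalBasis (Fin d) ℝ (Vec d)) (i₀ : Fin d)
    (ha : ‖a‖ = 1) {Θ : ℝ} (hΘ : 1 - (inner ℝ (u i₀) a : ℝ) ^ 2 ≤ Θ) (v : Vec d) :
    ‖v - (inner ℝ v a : ℝ) • a‖ ^ 2 ≤ 2 * Θ * (inner ℝ (u i₀) v : ℝ) ^ 2 +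
      2 * ∑ i ∈ Finset.univ.erase i₀, (inner ℝ (u i) v : ℝ) ^ 2 := by
  have hP : ∀ z : Vec d, ‖z - (inner ℝ z a : ℝ) • a‖ ^ 2 = ‖z‖ ^ 2 - (inner ℝ z a : ℝ) ^ 2 := by
    intro z
    rw [norm_sub_sq_real, inner_smul_right, norm_smul, ha, mul_one, Real.norm_eq_abs, sq_abs]
    ring
  set x : ℝ := inner ℝ (u i₀) v with hx
  set y := v - x • u i₀ with hy
  have hv : v - (inner ℝ v a : ℝ) • a =
      x • (u i₀ - (inner ℝ (u i₀) a : ℝ) • a) + (y - (inner ℝ y a : ℝ) • a) := by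
    rw [hy, inner_sub_left, inner_smul_left]
    simp only [conj_trivial]
    module
  have hyn : ‖y‖ ^ 2 = ∑ i ∈ Finset.univ.erase i₀, (inner ℝ (u i) v : ℝ) ^ 2 := by
    rw [← sum_inner_sq u y, ← Finset.add_sum_erase _ _ (Finset.mem_univ i₀)]
    have h0 : (inner ℝ (u i₀) y : ℝ) = 0 := by
      rw [hy, inner_sub_right, inner_smul_right]; simp [hx]
    rw [h0]
    simp only [ne_eq, OfNat.ofNat_ne_zero, not_false_eq_true, zero_pow, zero_add]
    refine Finset.sum_congr rfl fun i hi => ?_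
    rw [hy, inner_sub_right, inner_smul_right, u.inner_eq_zero (Finset.ne_of_mem_erase hi)]
    simp
  have h1 := hP (u i₀)
  have h2 := hP y
  rw [hv, ← hyn]
  have h3 : ‖x • (u i₀ - (inner ℝ (u i₀) a : ℝ) • a) + (y - (inner ℝ y a : ℝ) • a)‖ ^ 2 ≤
      2 * (‖x • (u i₀ - (inner ℝ (u i₀) a : ℝ) • a)‖ ^ 2 + ‖y - (inner ℝ y a : ℝ) • a‖ ^ 2) :=
    (pow_le_pow_left₀ (norm_nonneg _) (norm_add_le _ _) 2).trans add_sq_le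
  rw [norm_smul, mul_pow, h1, h2, Real.norm_eq_abs, sq_abs] at h3
  have h4 : ‖u i₀‖ = 1 := by simp
  rw [h4] at h3
  nlinarith [sq_nonneg (inner ℝ y a : ℝ), mul_le_mul_of_nonneg_left hΘ (sq_nonneg x)]

end Loop

/-- If a walk is frozen as soon as it leaves `[-b, b]` and the frozen walk ends inside, then the
walk never left. -/
theorem abs_sum_le_of_abs_stopped_sum_le {m g : ℕ → ℝ} {b : ℝ} {T : ℕ}
    (h1 : ∀ j, (∀ k ≤ j, |∑ i ∈ Finset.range k, m i| ≤ b) → g j = 1)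
    (h0 : ∀ j, ¬(∀ k ≤ j, |∑ i ∈ Finset.range k, m i| ≤ b) → g j = 0)
    (hT : |∑ i ∈ Finset.range T, g i * m i| ≤ b) :
    ∀ t ≤ T, |∑ i ∈ Finset.range t, m i| ≤ b := by
  classical
  by_contra! hcon
  set t := Nat.find hcon with ht
  obtain ⟨htT, hlt⟩ := Nat.find_spec hcon
  have hmin : ∀ k < t, |∑ i ∈ Finset.range k, m i| ≤ b := by
    intro k hk
    by_contra hk'
    exact Nat.find_min hcon hk ⟨by omega, not_le.1 hk'⟩
  have e : ∑ i ∈ Finset.range T, g i * m i = ∑ i ∈ Finset.range t, m i := by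
    rw [← Finset.sum_range_add_sum_Ico _ htT]
    have e2 : ∑ i ∈ Finset.Ico t T, g i * m i = 0 := by
      refine Finset.sum_eq_zero fun i hi => ?_
      rw [h0 i fun hk => absurd (hk t (Finset.mem_Ico.1 hi).1) (not_le.2 hlt), zero_mul]
    rw [e2, add_zero]
    refine Finset.sum_congr rfl fun i hi => ?_
    rw [h1 i fun k hk => hmin k (hk.trans_lt (Finset.mem_range.1 hi)), one_mul]
  rw [e] at hT
  exact absurd hT (not_le.2 hlt)

/-- The moment recursion closes when the noise level `η` is small against the spectral gap `g`.
There is no contribution of `e 0`, so that an epoch of a single step is noiseless. -/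
theorem sum_sq_mul_le {P e : ℕ → ℝ} {g K : ℝ} {t : ℕ} (hP : ∀ t, 0 ≤ P t) (hg : 0 ≤ g)
    (hPP : ∀ i j, g * (P i * P j) ≤ P (i + j + 1)) (hK : 0 ≤ K) (he0 : e 0 ≤ 0)
    (he : ∀ j ≤ t, e j ≤ K * P j ^ 2) :
    g ^ 2 * ∑ j ∈ Finset.range (t + 1), P (t - j) ^ 2 * e j ≤ K * t * P (t + 1) ^ 2 := by
  rw [Finset.sum_range_succ', mul_add, Finset.mul_sum]
  have h1 : ∀ j ∈ Finset.range t, g ^ 2 * (P (t - (j + 1)) ^ 2 * e (j + 1)) ≤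
      K * P (t + 1) ^ 2 := by
    intro j hj
    have hj := Finset.mem_range.1 hj
    have h2 := hPP (t - (j + 1)) (j + 1)
    rw [show t - (j + 1) + (j + 1) + 1 = t + 1 by omega] at h2
    have h3 : 0 ≤ g * (P (t - (j + 1)) * P (j + 1)) :=
      mul_nonneg hg (mul_nonneg (hP _) (hP _))
    calc g ^ 2 * (P (t - (j + 1)) ^ 2 * e (j + 1))
        ≤ g ^ 2 * (P (t - (j + 1)) ^ 2 * (K * P (j + 1) ^ 2)) := by
          gcongr; exact he _ (by omega)
      _ = K * (g * (P (t - (j + 1)) * P (j + 1))) ^ 2 := by ring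
      _ ≤ K * P (t + 1) ^ 2 := by gcongr
  have h2 : g ^ 2 * (P (t - 0) ^ 2 * e 0) ≤ 0 := by
    have : 0 ≤ g ^ 2 * P (t - 0) ^ 2 := by positivity
    nlinarith
  have h3 := Finset.sum_le_sum h1
  rw [Finset.sum_const, Finset.card_range, nsmul_eq_mul] at h3
  linarith

/-- By induction, a sequence satisfying the moment recursion at most doubles its noiseless bound. -/
theorem le_of_moment_recursion {P e : ℕ → ℝ} {g Θ η : ℝ} {T : ℕ} (hP : ∀ t, 0 ≤ P t) (hg : 0 < g)
    (hPP : ∀ i j, g * (P i * P j) ≤ P (i + j + 1)) (hΘ : 0 ≤ Θ) (hη : 0 ≤ η) (he0 : e 0 ≤ 0)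
    (hT : 8 * (η * T) ≤ g ^ 2)
    (hrec : ∀ t, e (t + 1) ≤ 8 * Θ * P (t + 1) ^ 2 +
      4 * (η * ∑ j ∈ Finset.range (t + 1), P (t - j) ^ 2 * e j)) :
    ∀ t ≤ T, e t ≤ 16 * Θ * P t ^ 2 := by
  intro t
  induction t using Nat.strong_induction_on with
  | _ t ih =>
    intro ht
    cases t with
    | zero => exact he0.trans (by positivity)
    | succ t =>
      have h1 := sum_sq_mul_le (K := 16 * Θ) (t := t) hP hg.le hPP (by positivity) he0
        fun j hj => ih j (by omega) (by omega)
      set S := ∑ j ∈ Finset.range (t + 1), P (t - j) ^ 2 * e j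
      have hg2 : 0 < g ^ 2 := by positivity
      have htT : (t : ℝ) ≤ T := by exact_mod_cast (by omega : t ≤ T)
      have h2 : g ^ 2 * (η * S) ≤ g ^ 2 * (2 * Θ * P (t + 1) ^ 2) := by
        calc g ^ 2 * (η * S) = η * (g ^ 2 * S) := by ring
          _ ≤ η * (16 * Θ * t * P (t + 1) ^ 2) := by gcongr
          _ ≤ η * (16 * Θ * T * P (t + 1) ^ 2) := by gcongr
          _ = (8 * (η * T)) * (2 * Θ * P (t + 1) ^ 2) := by ring
          _ ≤ g ^ 2 * (2 * Θ * P (t + 1) ^ 2) := by gcongr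
      have h3 := le_of_mul_le_mul_left h2 hg2
      linarith [hrec t]

/-! ### One epoch -/

/-- The randomness of one epoch: `X t i` is the `i`-th matrix of the `t`-th mini-batch, `m t i` is
what is known just before it is drawn, and `w` is the (random) anchor, known from the beginning. -/
structure IsEpoch {d : ℕ} {Ω : Type*} {m0 : MeasurableSpace Ω} (μ : Measure Ω)
    (m : ℕ → ℕ → MeasurableSpace Ω) (A : Op d) (σ : ℝ) (X : ℕ → ℕ → Ω → Op d) (w : Ω → Vec d) :
    Prop where
  le : ∀ t i, m t i ≤ m0
  mono : ∀ t i t' i', t' < t ∨ t' = t ∧ i' ≤ i → m t' i' ≤ m t i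
  adapted : ∀ t i t' i', t' < t ∨ t' = t ∧ i' < i → BddMeas μ (m t i) (X t' i')
  indep : ∀ t i, Indep (MeasurableSpace.comap (X t i) inferInstance) (m t i) μ
  mean : ∀ t i, ∫ ω, X t i ω ∂μ = A
  variance : ∀ t i, ∫ ω, ‖X t i ω - A‖ ^ 2 ∂μ = σ ^ 2
  start : BddMeas μ (m 0 0) w

namespace IsEpoch

variable {d : ℕ} {Ω : Type*} {m0 : MeasurableSpace Ω} {μ : Measure Ω}
  {m : ℕ → ℕ → MeasurableSpace Ω} {A : Op d} {σ : ℝ} {X : ℕ → ℕ → Ω → Op d} {w : Ω → Vec d}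

theorem bddMeas (h : IsEpoch μ m A σ X w) (t i : ℕ) : BddMeas μ m0 (X t i) :=
  (h.adapted (t + 1) 0 t i (Or.inl (by omega))).mono (h.le _ _)

theorem bddMeas_sub (h : IsEpoch μ m A σ X w) (t i : ℕ) : BddMeas μ m0 fun ω => X t i ω - A :=
  (h.bddMeas t i).sub (BddMeas.const A)

theorem indep_sub (h : IsEpoch μ m A σ X w) (t i : ℕ) :
    Indep (MeasurableSpace.comap (fun ω => X t i ω - A) inferInstance) (m t i) μ := by
  refine indep_of_indep_of_le_left (h.indep t i) ?_
  have hφ : Measurable fun L : Op d => L - A := by fun_prop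
  rw [show (fun ω => X t i ω - A) = (fun L : Op d => L - A) ∘ X t i from rfl,
    ← MeasurableSpace.comap_comp]
  exact MeasurableSpace.comap_mono hφ.comap_le

variable {β : ℝ} {s : ℕ}

theorem bddMeas_rawLoop (h : IsEpoch μ m A σ X w) (t : ℕ) :
    BddMeas μ (m t 0) (fun ω => (rawLoop A β s (w ω) (fun t i => X t i ω) t).1) ∧
      BddMeas μ (m t 0) (fun ω => (rawLoop A β s (w ω) (fun t i => X t i ω) t).2) := by
  induction t with
  | zero => exact ⟨BddMeas.const 0, h.start⟩
  | succ t ih =>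
    have hle : m t 0 ≤ m (t + 1) 0 := h.mono _ _ _ _ (Or.inl (by omega))
    have h0 : m 0 0 ≤ m (t + 1) 0 := h.mono _ _ _ _ (Or.inl (by omega))
    have h1 := ih.1.mono hle
    have h2 := ih.2.mono hle
    have hw := h.start.mono h0
    refine ⟨h2, ?_⟩
    simp only [rawLoop]
    refine BddMeas.sub (BddMeas.add (BddMeas.smul (BddMeas.const _) (BddMeas.sum fun i _ => ?_))
      (BddMeas.smul (h2.inner hw) (BddMeas.apply (BddMeas.const A) hw)))
      (BddMeas.smul (BddMeas.const β) h1)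
    exact BddMeas.apply (h.adapted _ _ t i (Or.inl (by omega)))
      (h2.sub (BddMeas.smul (h2.inner hw) hw))

theorem bddMeas_residual (h : IsEpoch μ m A σ X w) (t : ℕ) :
    BddMeas μ (m t 0) fun ω => residual A β s (w ω) (fun t i => X t i ω) t := by
  have h2 := (h.bddMeas_rawLoop (β := β) (s := s) t).2
  have hw : BddMeas μ (m t 0) w := h.start.mono (h.mono _ _ _ _ (by omega))
  exact h2.sub (BddMeas.smul (h2.inner hw) hw)

theorem bddMeas_noise (h : IsEpoch μ m A σ X w) {t T : ℕ} (ht : t < T) :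
    BddMeas μ (m T 0) fun ω => noise A β s (w ω) (fun t i => X t i ω) t := by
  have hR := (h.bddMeas_residual (β := β) (s := s) t).mono (h.mono T 0 t 0 (Or.inl ht))
  exact BddMeas.smul (BddMeas.const _) (BddMeas.sum fun i _ =>
    BddMeas.apply ((h.adapted _ _ t i (Or.inl ht)).sub (BddMeas.const A)) hR)

variable [IsProbabilityMeasure μ]

theorem mean_sub (h : IsEpoch μ m A σ X w) (t i : ℕ) : ∫ ω, (X t i ω - A) ∂μ = 0 := by
  rw [integral_sub ((h.bddMeas t i).integrable le_rfl) (integrable_const _), h.mean]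
  simp

/-- The noise is uncorrelated with the past. -/
theorem integral_inner_noise_eq_zero (h : IsEpoch μ m A σ X w) {t : ℕ} {U : Ω → Vec d}
    (hU : BddMeas μ (m t 0) U) :
    ∫ ω, inner ℝ (U ω) (noise A β s (w ω) (fun t i => X t i ω) t) ∂μ = 0 := by
  have hR := h.bddMeas_residual (β := β) (s := s) t
  have hz : ∀ i, ∫ ω, inner ℝ (U ω)
      ((X t i ω - A) (residual A β s (w ω) (fun t i => X t i ω) t)) ∂μ = 0 := fun i =>
    have hle : m t 0 ≤ m t i := h.mono _ _ _ _ (by omega)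
    integral_inner_apply_eq_zero (h.le t i) (h.bddMeas_sub t i) (h.indep_sub t i)
      (h.mean_sub t i) (hU.mono hle) (hR.mono hle)
  simp only [noise, inner_smul_right, inner_sum]
  rw [integral_const_mul, integral_finsetSum, Finset.sum_eq_zero fun i _ => hz i, mul_zero]
  intro i _
  exact ((hU.mono (h.le _ _)).inner ((h.bddMeas_sub t i).apply (hR.mono (h.le _ _)))).integrable
    le_rfl

/-- Averaging over a mini-batch of size `s` divides the variance by `s`. -/
theorem integral_norm_sq_noise_le (h : IsEpoch μ m A σ X w) (hs : 1 ≤ s) (t : ℕ) :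
    ∫ ω, ‖noise A β s (w ω) (fun t i => X t i ω) t‖ ^ 2 ∂μ ≤
      σ ^ 2 / s * ∫ ω, ‖residual A β s (w ω) (fun t i => X t i ω) t‖ ^ 2 ∂μ := by
  have hs' : (0 : ℝ) < s := by positivity
  have hR := h.bddMeas_residual (β := β) (s := s) t
  set R : Ω → Vec d := fun ω => residual A β s (w ω) (fun t i => X t i ω) t with hRdef
  have hf : ∀ i, BddMeas μ m0 fun ω => (X t i ω - A) (R ω) := fun i =>
    (h.bddMeas_sub t i).apply (hR.mono (h.le _ _))
  have horth : ∀ i j, i < j → j < s →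
      ∫ ω, inner ℝ ((X t i ω - A) (R ω)) ((X t j ω - A) (R ω)) ∂μ = 0 := by
    intro i j hij _
    have hRj : BddMeas μ (m t j) R := hR.mono (h.mono _ _ _ _ (by omega))
    refine integral_inner_apply_eq_zero (h.le t j) (h.bddMeas_sub t j) (h.indep_sub t j)
      (h.mean_sub t j) (BddMeas.apply ?_ hRj) hRj
    exact (h.adapted t j t i (Or.inr ⟨rfl, hij⟩)).sub (BddMeas.const A)
  have hsum := integral_norm_sq_sum_eq (n := s) (fun i _ => hf i) horth
  have hle : ∑ i ∈ Finset.range s, ∫ ω, ‖(X t i ω - A) (R ω)‖ ^ 2 ∂μ ≤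
      s * (σ ^ 2 * ∫ ω, ‖R ω‖ ^ 2 ∂μ) := by
    refine (Finset.sum_le_sum fun i _ => integral_norm_sq_apply_le (h.le t i) (h.bddMeas_sub t i)
      (h.indep_sub t i) (h.variance t i) (hR.mono (h.mono _ _ _ _ (by omega)))).trans ?_
    simp
  simp only [noise, norm_smul, mul_pow]
  rw [integral_const_mul]
  change ‖1 / (s : ℝ)‖ ^ 2 * ∫ ω, ‖∑ i ∈ Finset.range s, (X t i ω - A) (R ω)‖ ^ 2 ∂μ ≤ _
  rw [hsum, Real.norm_of_nonneg (by positivity)]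
  calc (1 / (s : ℝ)) ^ 2 * ∑ i ∈ Finset.range s, ∫ ω, ‖(X t i ω - A) (R ω)‖ ^ 2 ∂μ
      ≤ (1 / (s : ℝ)) ^ 2 * (s * (σ ^ 2 * ∫ ω, ‖R ω‖ ^ 2 ∂μ)) := by gcongr
    _ = σ ^ 2 / s * ∫ ω, ‖R ω‖ ^ 2 ∂μ := by field_simp

/-- Orthogonality of noise coordinates with predictable weights. -/
theorem integral_sq_sum_noise (h : IsEpoch μ m A σ X w) (x : Vec d) {g : ℕ → Ω → ℝ}
    (hg : ∀ t, BddMeas μ (m t 0) (g t)) (n : ℕ) :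
    ∫ ω, (∑ t ∈ Finset.range n,
        g t ω * inner ℝ x (noise A β s (w ω) (fun t i => X t i ω) t)) ^ 2 ∂μ =
      ∑ t ∈ Finset.range n,
        ∫ ω, (g t ω * inner ℝ x (noise A β s (w ω) (fun t i => X t i ω) t)) ^ 2 ∂μ := by
  have hf : ∀ t T, t < T → BddMeas μ (m T 0) fun ω =>
      g t ω * inner ℝ x (noise A β s (w ω) (fun t i => X t i ω) t) := fun t T ht =>
    ((hg t).mono (h.mono _ _ _ _ (Or.inl ht))).mul
      ((BddMeas.const x).inner (h.bddMeas_noise ht))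
  have := integral_norm_sq_sum_eq (n := n) (fun t _ => (hf t (t + 1) (by omega)).mono (h.le _ _))
    (fun i j hij _ => ?_)
  · simpa only [Real.norm_eq_abs, sq_abs] using this
  · have h0 := h.integral_inner_noise_eq_zero (β := β) (s := s) (t := j)
      (((hf i j hij).mul (hg j)).smul (BddMeas.const x))
    rw [← h0]
    refine integral_congr_ae (ae_of_all _ fun ω => ?_)
    simp only [inner_smul_left, RCLike.inner_apply, conj_trivial]
    ring

end IsEpoch

section Pointwise

variable {d : ℕ} {A : Op d} {β : ℝ} {s : ℕ} {a : Vec d} {B : ℕ → ℕ → Op d}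
  {hd : 2 ≤ d} {lam : Fin d → ℝ} {u : OrthonormalBasis (Fin d) ℝ (Vec d)}

/-- The accumulated noise in the coordinate along `x`, propagated with the eigenvalue `l`: the second
summand in `inner_rawLoop_eq`. -/
noncomputable def coordNoise (A : Op d) (β : ℝ) (s : ℕ) (a : Vec d) (B : ℕ → ℕ → Op d) (l : ℝ)
    (x : Vec d) (t : ℕ) : ℝ :=
  ∑ j ∈ Finset.range t, momentumPoly β l (t - 1 - j) * inner ℝ x (noise A β s a B j)

theorem inner_rawLoop_sq_le (h : IsPCATarget hd A lam u) (hs : 1 ≤ s) (i : Fin d) {t : ℕ} {q : ℝ}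
    (hq : |momentumPoly β (lam i) t| ≤ q) :
    (inner ℝ (u i) (rawLoop A β s a B t).2 : ℝ) ^ 2 ≤ 2 * q ^ 2 * (inner ℝ (u i) a : ℝ) ^ 2 +
      2 * coordNoise A β s a B (lam i) (u i) t ^ 2 := by
  rw [inner_rawLoop_eq h hs i t]
  have h1 : momentumPoly β (lam i) t ^ 2 ≤ q ^ 2 := by
    rw [← sq_abs (momentumPoly β (lam i) t)]
    gcongr
  refine (add_sq_le (a := momentumPoly β (lam i) t * inner ℝ (u i) a)
    (b := coordNoise A β s a B (lam i) (u i) t)).trans ?_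
  rw [mul_pow]
  nlinarith [mul_le_mul_of_nonneg_right h1 (sq_nonneg (inner ℝ (u i) a : ℝ))]

theorem sum_erase_inner_sq_le (u : OrthonormalBasis (Fin d) ℝ (Vec d)) (i₀ : Fin d) (ha : ‖a‖ = 1)
    {Θ : ℝ} (hΘ : 1 - (inner ℝ (u i₀) a : ℝ) ^ 2 ≤ Θ) :
    ∑ i ∈ Finset.univ.erase i₀, (inner ℝ (u i) a : ℝ) ^ 2 ≤ Θ := by
  have := sum_inner_sq u a
  rw [← Finset.add_sum_erase _ _ (Finset.mem_univ i₀), ha] at this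
  linarith

theorem sum_erase_inner_rawLoop_sq_le (h : IsPCATarget hd A lam u) (hs : 1 ≤ s) (i₀ : Fin d)
    (ha : ‖a‖ = 1) {Θ : ℝ} (hΘ : 1 - (inner ℝ (u i₀) a : ℝ) ^ 2 ≤ Θ) {t : ℕ} {q : ℝ}
    (hq : ∀ i ≠ i₀, |momentumPoly β (lam i) t| ≤ q) :
    ∑ i ∈ Finset.univ.erase i₀, (inner ℝ (u i) (rawLoop A β s a B t).2 : ℝ) ^ 2 ≤
      2 * q ^ 2 * Θ +
        2 * ∑ i ∈ Finset.univ.erase i₀, coordNoise A β s a B (lam i) (u i) t ^ 2 := by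
  refine (Finset.sum_le_sum fun i hi => inner_rawLoop_sq_le h hs i
    (hq i (Finset.ne_of_mem_erase hi))).trans ?_
  rw [Finset.sum_add_distrib, ← Finset.mul_sum, ← Finset.mul_sum]
  gcongr
  exact sum_erase_inner_sq_le u i₀ ha hΘ

/-- The mean square of the residual is of order `Θ`, up to the noise collected so far. -/
theorem norm_residual_sq_le (h : IsPCATarget hd A lam u) (hs : 1 ≤ s) (i₀ : Fin d)
    (ha : ‖a‖ = 1) {Θ : ℝ} (hΘ : 1 - (inner ℝ (u i₀) a : ℝ) ^ 2 ≤ Θ) (hΘ0 : 0 ≤ Θ) (hΘ1 : Θ ≤ 1)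
    {t : ℕ} {q : ℝ} (hq : ∀ i, |momentumPoly β (lam i) t| ≤ q) :
    ‖residual A β s a B t‖ ^ 2 ≤ 8 * Θ * q ^ 2 +
      4 * ∑ i, coordNoise A β s a B (lam i) (u i) t ^ 2 := by
  have h1 := norm_sub_inner_smul_sq_le u i₀ ha hΘ (rawLoop A β s a B t).2
  have h2 := sum_erase_inner_rawLoop_sq_le (β := β) (B := B) h hs i₀ ha hΘ fun i _ => hq i
  have h3 := inner_rawLoop_sq_le (a := a) (B := B) h hs i₀ (hq i₀)
  have h4 : (inner ℝ (u i₀) a : ℝ) ^ 2 ≤ 1 := by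
    have := Finset.single_le_sum (f := fun i => (inner ℝ (u i) a : ℝ) ^ 2)
      (fun _ _ => sq_nonneg _) (Finset.mem_univ i₀)
    rwa [sum_inner_sq, ha, one_pow] at this
  rw [← Finset.add_sum_erase _ _ (Finset.mem_univ i₀)]
  change ‖residual A β s a B t‖ ^ 2 ≤ _ at h1
  set c := coordNoise A β s a B (lam i₀) (u i₀) t ^ 2 with hc
  have hc0 : 0 ≤ c := sq_nonneg _
  have h5 : (inner ℝ (u i₀) (rawLoop A β s a B t).2 : ℝ) ^ 2 ≤ 2 * q ^ 2 + 2 * c := by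
    nlinarith [sq_nonneg q]
  have h6 := mul_le_mul_of_nonneg_left h5 hΘ0
  have h7 : Θ * c ≤ c := by nlinarith
  linarith

/-- The outcome of an epoch on the good event. The signal bound keeps every iterate away from
zero, hence the normalised and the unnormalised loop agree up to a scalar. -/
theorem inner_loop_good (h : IsPCATarget hd A lam u) (hs : 1 ≤ s) (i₀ : Fin d)
    (ha : ‖a‖ = 1) {Θ : ℝ} (hΘ : 1 - (inner ℝ (u i₀) a : ℝ) ^ 2 ≤ Θ) {T : ℕ} {q : ℝ} {P : ℕ → ℝ}
    (hP : ∀ t, 0 < P t) (hq : ∀ i ≠ i₀, |momentumPoly β (lam i) T| ≤ q)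
    (hqP : 32 * q ^ 2 ≤ P T ^ 2)
    (hsig : ∀ t ≤ T, 1 / 2 * P t ≤ |inner ℝ (u i₀) (rawLoop A β s a B t).2|)
    (hnoise : ∑ i, coordNoise A β s a B (lam i) (u i) T ^ 2 ≤ Θ * P T ^ 2 / 32) :
    ‖(inner_loop A β s a B T).2‖ = 1 ∧
      1 - (inner ℝ (u i₀) (inner_loop A β s a B T).2 : ℝ) ^ 2 ≤ Θ / 2 := by
  have hne : ∀ t ≤ T, (rawLoop A β s a B t).2 ≠ 0 := by
    intro t ht h0
    have := hsig t ht
    rw [h0, inner_zero_right, abs_zero] at this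
    linarith [hP t]
  have hΘ0 : 0 ≤ Θ :=
    (Finset.sum_nonneg fun i _ => sq_nonneg _).trans (sum_erase_inner_sq_le u i₀ ha hΘ)
  rw [inner_loop_eq ha hne, Prod.smul_snd]
  have h1 := sum_erase_inner_rawLoop_sq_le (B := B) h hs i₀ ha hΘ hq
  have h2 : ∑ i ∈ Finset.univ.erase i₀, coordNoise A β s a B (lam i) (u i) T ^ 2 ≤
      ∑ i, coordNoise A β s a B (lam i) (u i) T ^ 2 :=
    Finset.sum_le_sum_of_subset_of_nonneg (Finset.erase_subset _ _) fun _ _ _ => sq_nonneg _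
  have h3 := sum_inner_sq u (rawLoop A β s a B T).2
  rw [← Finset.add_sum_erase _ _ (Finset.mem_univ i₀)] at h3
  have h4 : P T ^ 2 ≤ 4 * (inner ℝ (u i₀) (rawLoop A β s a B T).2 : ℝ) ^ 2 := by
    rw [← sq_abs (inner ℝ (u i₀) (rawLoop A β s a B T).2 : ℝ)]
    nlinarith [hsig T le_rfl, hP T]
  set v := (rawLoop A β s a B T).2
  have hv : 0 < ‖v‖ := norm_pos_iff.2 (hne T le_rfl)
  refine ⟨by rw [norm_smul, norm_inv, norm_norm, inv_mul_cancel₀ hv.ne'], ?_⟩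
  rw [inner_smul_right, mul_pow, inv_pow, ← div_eq_inv_mul, one_sub_div (by positivity),
    div_le_iff₀ (by positivity)]
  set x : ℝ := inner ℝ (u i₀) v
  set Y := ∑ i ∈ Finset.univ.erase i₀, (inner ℝ (u i) v : ℝ) ^ 2
  have hY : 0 ≤ Y := Finset.sum_nonneg fun _ _ => sq_nonneg _
  have h5 := mul_le_mul_of_nonneg_right hqP hΘ0
  have h6 := mul_le_mul_of_nonneg_left h4 hΘ0
  have h7 := mul_nonneg hΘ0 hY
  rw [← h3]
  linarith

end Pointwise

namespace IsEpoch

variable {d : ℕ} {Ω : Type*} {m0 : MeasurableSpace Ω} {μ : Measure Ω}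
  {m : ℕ → ℕ → MeasurableSpace Ω} {A : Op d} {σ : ℝ} {X : ℕ → ℕ → Ω → Op d} {w : Ω → Vec d}
  {β : ℝ} {s : ℕ}

theorem bddMeas_coordNoise (h : IsEpoch μ m A σ X w) (l : ℝ) (x : Vec d) (t : ℕ) :
    BddMeas μ m0 fun ω => coordNoise A β s (w ω) (fun t i => X t i ω) l x t := by
  refine BddMeas.mono (m := m t 0) (BddMeas.sum fun j hj => ?_) (h.le _ _)
  exact (BddMeas.const _).mul ((BddMeas.const x).inner (h.bddMeas_noise hj))

variable [IsProbabilityMeasure μ]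

/-- The mean square of the noise collected in all coordinates, in terms of the residuals that
caused it. -/
theorem integral_sum_coordNoise_sq_le (h : IsEpoch μ m A σ X w) (hs : 1 ≤ s) (lam : Fin d → ℝ)
    (u : OrthonormalBasis (Fin d) ℝ (Vec d)) {P : ℕ → ℝ}
    (hP : ∀ i t, |momentumPoly β (lam i) t| ≤ P t) (t : ℕ) :
    ∫ ω, ∑ i, coordNoise A β s (w ω) (fun t i => X t i ω) (lam i) (u i) t ^ 2 ∂μ ≤
      σ ^ 2 / s * ∑ j ∈ Finset.range t, P (t - 1 - j) ^ 2 *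
        ∫ ω, ‖residual A β s (w ω) (fun t i => X t i ω) j‖ ^ 2 ∂μ := by
  have hN : ∀ j, BddMeas μ m0 fun ω => noise A β s (w ω) (fun t i => X t i ω) j := fun j =>
    (h.bddMeas_noise (Nat.lt_succ_self j)).mono (h.le _ _)
  have hNi : ∀ i j, Integrable (fun ω =>
      (inner ℝ (u i) (noise A β s (w ω) (fun t i => X t i ω) j) : ℝ) ^ 2) μ := fun i j =>
    (((BddMeas.const (u i)).inner (hN j)).comp (φ := fun x => x ^ 2) (by fun_prop)).integrable
      le_rfl
  rw [integral_finsetSum _ fun i _ => ((h.bddMeas_coordNoise (lam i) (u i) t).comp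
    (φ := fun x => x ^ 2) (by fun_prop)).integrable le_rfl]
  calc ∑ i, ∫ ω, coordNoise A β s (w ω) (fun t i => X t i ω) (lam i) (u i) t ^ 2 ∂μ
      = ∑ i, ∑ j ∈ Finset.range t, momentumPoly β (lam i) (t - 1 - j) ^ 2 *
          ∫ ω, (inner ℝ (u i) (noise A β s (w ω) (fun t i => X t i ω) j) : ℝ) ^ 2 ∂μ := by
        refine Finset.sum_congr rfl fun i _ => ?_
        rw [show (∫ ω, coordNoise A β s (w ω) (fun t i => X t i ω) (lam i) (u i) t ^ 2 ∂μ) = _ from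
          h.integral_sq_sum_noise (u i)
            (g := fun j _ => momentumPoly β (lam i) (t - 1 - j)) (fun j => BddMeas.const _) t]
        simp only [mul_pow, integral_const_mul]
    _ ≤ ∑ i, ∑ j ∈ Finset.range t, P (t - 1 - j) ^ 2 *
          ∫ ω, (inner ℝ (u i) (noise A β s (w ω) (fun t i => X t i ω) j) : ℝ) ^ 2 ∂μ := by
        refine Finset.sum_le_sum fun i _ => Finset.sum_le_sum fun j _ =>
          mul_le_mul_of_nonneg_right ?_ (integral_nonneg fun ω => by positivity)
        exact sq_le_sq.2 ((hP _ _).trans (le_abs_self _))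
    _ = ∑ j ∈ Finset.range t, P (t - 1 - j) ^ 2 *
          ∫ ω, ‖noise A β s (w ω) (fun t i => X t i ω) j‖ ^ 2 ∂μ := by
        rw [Finset.sum_comm]
        refine Finset.sum_congr rfl fun j _ => ?_
        rw [← Finset.mul_sum, ← integral_finsetSum _ fun i _ => hNi i j]
        simp only [sum_inner_sq]
    _ ≤ ∑ j ∈ Finset.range t, P (t - 1 - j) ^ 2 * (σ ^ 2 / s *
          ∫ ω, ‖residual A β s (w ω) (fun t i => X t i ω) j‖ ^ 2 ∂μ) := by
        gcongr with j _
        exact h.integral_norm_sq_noise_le hs j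
    _ = _ := by
        rw [Finset.mul_sum]
        exact Finset.sum_congr rfl fun j _ => by ring

end IsEpoch

/-- The analogue of `sum_sq_mul_le` for noise that is discounted by the growth factor `r`. -/
theorem sum_inv_pow_sq_mul_le {P e : ℕ → ℝ} {g K r : ℝ} {t : ℕ} (hP : ∀ t, 0 ≤ P t) (hg : 0 ≤ g)
    (hr : 0 < r) (hPr : ∀ j, g * P j ≤ r ^ (j + 1)) (hK : 0 ≤ K) (he0 : e 0 ≤ 0)
    (he : ∀ j ≤ t, e j ≤ K * P j ^ 2) :
    g ^ 2 * ∑ j ∈ Finset.range (t + 1), (1 / r ^ (j + 1)) ^ 2 * e j ≤ K * t := by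
  rw [Finset.sum_range_succ', mul_add, Finset.mul_sum]
  have h1 : ∀ j ∈ Finset.range t,
      g ^ 2 * ((1 / r ^ (j + 1 + 1)) ^ 2 * e (j + 1)) ≤ K := by
    intro j hj
    have hj := Finset.mem_range.1 hj
    have h2 : g * P (j + 1) / r ^ (j + 1 + 1) ≤ 1 := (div_le_one (by positivity)).2 (hPr (j + 1))
    have h3 : 0 ≤ g * P (j + 1) / r ^ (j + 1 + 1) := by have := hP (j + 1); positivity
    calc g ^ 2 * ((1 / r ^ (j + 1 + 1)) ^ 2 * e (j + 1))
        ≤ g ^ 2 * ((1 / r ^ (j + 1 + 1)) ^ 2 * (K * P (j + 1) ^ 2)) := by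
          gcongr; exact he _ (by omega)
      _ = K * (g * P (j + 1) / r ^ (j + 1 + 1)) ^ 2 := by ring
      _ ≤ K * 1 ^ 2 := by gcongr
      _ = K := by ring
  have h2 : g ^ 2 * ((1 / r ^ (0 + 1)) ^ 2 * e 0) ≤ 0 := by
    have : 0 ≤ g ^ 2 * (1 / r ^ (0 + 1)) ^ 2 := by positivity
    nlinarith
  have h3 := Finset.sum_le_sum h1
  rw [Finset.sum_const, Finset.card_range, nsmul_eq_mul] at h3
  linarith

namespace IsEpoch

variable {d : ℕ} {Ω : Type*} {m0 : MeasurableSpace Ω} {μ : Measure Ω} [IsProbabilityMeasure μ]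
  {m : ℕ → ℕ → MeasurableSpace Ω} {A : Op d} {σ : ℝ} {X : ℕ → ℕ → Ω → Op d} {w : Ω → Vec d}
  {β : ℝ} {s : ℕ}

/-- A maximal inequality of Kolmogorov type for the noise along a unit vector. It is proved by
switching the noise off once the walk has left `[-1/5, 1/5]`. -/
theorem measureReal_walk_le (h : IsEpoch μ m A σ X w) (hs : 1 ≤ s) {x : Vec d} (hx : ‖x‖ = 1)
    {r κ : ℝ} (hr : 0 < r) (T : ℕ)
    (hκ : 25 * (σ ^ 2 / s * ∑ j ∈ Finset.range T, (1 / r ^ (j + 1)) ^ 2 *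
      ∫ ω, ‖residual A β s (w ω) (fun t i => X t i ω) j‖ ^ 2 ∂μ) ≤ κ) :
    μ.real {ω | ¬ ∀ t ≤ T, |∑ j ∈ Finset.range t,
      inner ℝ x (noise A β s (w ω) (fun t i => X t i ω) j) / r ^ (j + 1)| ≤ 1 / 5} ≤ κ := by
  classical
  set N : ℕ → Ω → Vec d := fun j ω => noise A β s (w ω) (fun t i => X t i ω) j with hN
  set M : ℕ → Ω → ℝ := fun t ω => ∑ j ∈ Finset.range t, inner ℝ x (N j ω) / r ^ (j + 1) with hM
  set S : ℕ → Set Ω := fun j => {ω | ∀ k ≤ j, |M k ω| ≤ 1 / 5} with hS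
  set g : ℕ → Ω → ℝ := fun j => (S j).indicator fun _ => 1 / r ^ (j + 1) with hg
  have hMm : ∀ t, BddMeas μ (m t 0) (M t) := fun t => BddMeas.sum fun j hj => by
    simp only [div_eq_mul_inv]
    exact ((BddMeas.const x).inner (h.bddMeas_noise hj)).mul (BddMeas.const _)
  have hSm : ∀ j, MeasurableSet[m j 0] (S j) := by
    intro j
    have e : S j = ⋂ k ∈ Set.Iic j, {ω | |M k ω| ≤ 1 / 5} := by
      ext ω; simp [hS]
    rw [e]
    refine MeasurableSet.biInter (Set.finite_Iic j).countable fun k hk => ?_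
    have hk' : StronglyMeasurable[m j 0] (M k) :=
      (hMm k).meas.mono (h.mono _ _ _ _ (by have : k ≤ j := hk; omega))
    exact measurableSet_le (continuous_abs.measurable.comp hk'.measurable) measurable_const
  have hgm : ∀ j, BddMeas μ (m j 0) (g j) := fun j =>
    ⟨stronglyMeasurable_const.indicator (hSm j), 1 / r ^ (j + 1), ae_of_all _ fun ω =>
      (norm_indicator_le_norm_self _ _).trans (by rw [Real.norm_of_nonneg (by positivity)])⟩
  have hNm : ∀ j, BddMeas μ m0 (N j) := fun j =>
    (h.bddMeas_noise (Nat.lt_succ_self j)).mono (h.le _ _)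
  have hterm : ∀ j, BddMeas μ m0 fun ω => g j ω * inner ℝ x (N j ω) := fun j =>
    ((hgm j).mono (h.le _ _)).mul ((BddMeas.const x).inner (hNm j))
  have hsq : BddMeas μ m0 fun ω => (∑ j ∈ Finset.range T, g j ω * inner ℝ x (N j ω)) ^ 2 :=
    (BddMeas.sum fun j _ => hterm j).comp (φ := fun y => y ^ 2) (by fun_prop)
  have hE : ∫ ω, (∑ j ∈ Finset.range T, g j ω * inner ℝ x (N j ω)) ^ 2 ∂μ ≤ κ * (1 / 25) := by
    have h1 := h.integral_sq_sum_noise (β := β) (s := s) x hgm T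
    rw [h1]
    have h2 : ∀ j ∈ Finset.range T, ∫ ω, (g j ω * inner ℝ x (N j ω)) ^ 2 ∂μ ≤
        σ ^ 2 / s * ((1 / r ^ (j + 1)) ^ 2 *
          ∫ ω, ‖residual A β s (w ω) (fun t i => X t i ω) j‖ ^ 2 ∂μ) := by
      intro j _
      calc ∫ ω, (g j ω * inner ℝ x (N j ω)) ^ 2 ∂μ
          ≤ ∫ ω, (1 / r ^ (j + 1)) ^ 2 * ‖N j ω‖ ^ 2 ∂μ := by
            refine integral_mono (((hterm j).comp (φ := fun y => y ^ 2) (by fun_prop)).integrable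
              le_rfl) (((hNm j).norm_sq.integrable le_rfl).const_mul _) fun ω => ?_
            simp only
            rw [mul_pow]
            have h3 : g j ω ^ 2 ≤ (1 / r ^ (j + 1)) ^ 2 := by
              have := norm_indicator_le_norm_self (s := S j) (fun _ => 1 / r ^ (j + 1)) ω
              exact sq_le_sq.2 this
            have h4 : (inner ℝ x (N j ω) : ℝ) ^ 2 ≤ ‖N j ω‖ ^ 2 := by
              refine sq_le_sq.2 ?_
              have := abs_real_inner_le_norm x (N j ω)
              rwa [hx, one_mul, ← abs_norm] at this
            gcongr
        _ = (1 / r ^ (j + 1)) ^ 2 * ∫ ω, ‖N j ω‖ ^ 2 ∂μ := integral_const_mul _ _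
        _ ≤ (1 / r ^ (j + 1)) ^ 2 * (σ ^ 2 / s *
              ∫ ω, ‖residual A β s (w ω) (fun t i => X t i ω) j‖ ^ 2 ∂μ) := by
            gcongr
            exact h.integral_norm_sq_noise_le hs j
        _ = _ := by ring
    have h5 := Finset.sum_le_sum h2
    rw [← Finset.mul_sum] at h5
    linarith
  refine le_trans (measureReal_mono ?_) (measureReal_lt_le (hsq.integrable le_rfl)
    (fun ω => sq_nonneg _) (by norm_num) hE)
  intro ω hω
  by_contra hcon
  refine hω ?_
  have h6 : (∑ j ∈ Finset.range T, g j ω * inner ℝ x (N j ω)) ^ 2 ≤ 1 / 25 := not_lt.1 hcon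
  refine abs_sum_le_of_abs_stopped_sum_le (m := fun j => inner ℝ x (N j ω) / r ^ (j + 1))
    (g := fun j => (S j).indicator (fun _ => (1 : ℝ)) ω)
    (fun j hj => Set.indicator_of_mem (s := S j) hj _)
    (fun j hj => Set.indicator_of_notMem (s := S j) hj _) ?_
  have e : ∀ j, (S j).indicator (fun _ => (1 : ℝ)) ω * (inner ℝ x (N j ω) / r ^ (j + 1)) =
      g j ω * inner ℝ x (N j ω) := by
    intro j
    by_cases hj : ω ∈ S j
    · simp only [hg, Set.indicator_of_mem hj]; ring
    · simp only [hg, Set.indicator_of_notMem hj]; ring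
  simp only [e]
  exact abs_le_of_sq_le_sq (by norm_num; linarith) (by norm_num)

/-- One epoch halves the error except with probability `δ / 2`. -/
theorem measureReal_bad_le (h : IsEpoch μ m A σ X w) {hd : 2 ≤ d} {lam : Fin d → ℝ}
    {u : OrthonormalBasis (Fin d) ℝ (Vec d)} (hA : IsPCATarget hd A lam u) (hs : 1 ≤ s)
    {r v : ℝ} (hv : 0 ≤ v) (hr : v < r) (hl : lam ⟨0, by omega⟩ = r + v) (hβ : β = r * v)
    (hlam : lam ⟨1, by omega⟩ ≤ 2 * √β) (hw : ∀ ω, ‖w ω‖ = 1) {Θ : ℝ} (hΘ0 : 0 < Θ)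
    (hΘ1 : Θ ≤ 1 / 2) (hΘ : ∀ ω, 1 - (inner ℝ (u ⟨0, by omega⟩) (w ω) : ℝ) ^ 2 ≤ Θ) {T : ℕ} {δ : ℝ}
    (hδ : δ ≤ 1) (hκ : 2048 * (σ ^ 2 / s * T) ≤ δ * (r - v) ^ 2)
    (hdet : 8 * ((T + 2) * √β ^ (T + 1)) ≤ momentumPoly β (lam ⟨0, by omega⟩) (T + 1)) :
    μ.real {ω | ¬ (‖(inner_loop A β s (w ω) (fun t i => X t i ω) (T + 1)).2‖ = 1 ∧
      1 - (inner ℝ (u ⟨0, by omega⟩)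
        (inner_loop A β s (w ω) (fun t i => X t i ω) (T + 1)).2 : ℝ) ^ 2 ≤ Θ / 2)} ≤ δ / 2 := by
  set i₀ : Fin d := ⟨0, by omega⟩ with hi₀
  set P : ℕ → ℝ := momentumPoly β (lam i₀) with hPdef
  have hPeq : ∀ t, P t = momentumPoly (r * v) (r + v) t := fun t => by rw [hPdef, hl, hβ]
  have hr0 : 0 < r := hv.trans_lt hr
  have hg : 0 < r - v := sub_pos.2 hr
  have hβ0 : 0 ≤ β := hβ ▸ mul_nonneg hr0.le hv
  have hb : √β ^ 2 = r * v := by rw [Real.sq_sqrt hβ0, hβ]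
  have hP0 : ∀ t, 0 < P t := fun t => by rw [hPeq]; exact momentumPoly_pos hv hr t
  have hPP : ∀ i j, (r - v) * (P i * P j) ≤ P (i + j + 1) := fun i j => by
    simp only [hPeq]; exact momentumPoly_mul_le hv hr i j
  have hPr : ∀ j, (r - v) * P j ≤ r ^ (j + 1) := fun j => by
    rw [hPeq]; exact sub_mul_momentumPoly_le hv j
  have hsmall : ∀ i ≠ i₀, ∀ t, |momentumPoly β (lam i) t| ≤ (t + 1) * √β ^ t := by
    intro i hi t
    refine abs_momentumPoly_le hβ0 (hA.nonneg i) (le_trans (hA.antitone ?_) hlam) t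
    rw [Fin.le_def]
    have : i.val ≠ 0 := fun h0 => hi (Fin.ext h0)
    simp only
    omega
  have hPle : ∀ i t, |momentumPoly β (lam i) t| ≤ P t := by
    intro i t
    by_cases hi : i = i₀
    · rw [hi]; exact (abs_of_pos (hP0 t)).le
    · refine (hsmall i hi t).trans ?_
      rw [hPeq]
      exact succ_mul_pow_le_momentumPoly hv hr.le hb t
  set η : ℝ := σ ^ 2 / s with hη
  have hη0 : 0 ≤ η := by positivity
  have hηT : 0 ≤ η * T := by positivity
  set e : ℕ → ℝ := fun j => ∫ ω, ‖residual A β s (w ω) (fun t i => X t i ω) j‖ ^ 2 ∂μ with he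
  -- the first step of an epoch starts at the anchor and is exact
  have he0 : e 0 ≤ 0 := by
    refine le_of_eq ?_
    simp only [he, residual, rawLoop, real_inner_self_eq_norm_sq, hw]
    simp
  have hC : ∀ t, BddMeas μ m0 fun ω =>
      ∑ i, coordNoise A β s (w ω) (fun t i => X t i ω) (lam i) (u i) t ^ 2 := fun t => by
    have h1 : ∀ i, BddMeas μ m0 fun ω =>
        coordNoise A β s (w ω) (fun t i => X t i ω) (lam i) (u i) t ^ 2 := fun i =>
      (h.bddMeas_coordNoise (lam i) (u i) t).comp (φ := fun x => x ^ 2) (by fun_prop)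
    exact BddMeas.finset_sum fun i _ => h1 i
  have hgap : 2048 * (η * T) ≤ (r - v) ^ 2 := by nlinarith [sq_nonneg (r - v)]
  have hmom : ∀ t ≤ T, e t ≤ 16 * Θ * P t ^ 2 := by
    refine le_of_moment_recursion (fun t => (hP0 t).le) hg hPP hΘ0.le hη0 he0 (by linarith)
      fun t => ?_
    have h1 := h.integral_sum_coordNoise_sq_le (β := β) hs lam u hPle (t + 1)
    have h2 : e (t + 1) ≤ ∫ ω, (8 * Θ * P (t + 1) ^ 2 + 4 *
        ∑ i, coordNoise A β s (w ω) (fun t i => X t i ω) (lam i) (u i) (t + 1) ^ 2) ∂μ :=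
      integral_mono (((h.bddMeas_residual (t + 1)).mono (h.le _ _)).norm_sq.integrable le_rfl)
        ((integrable_const _).add (((hC (t + 1)).integrable le_rfl).const_mul 4)) fun ω =>
        norm_residual_sq_le hA hs i₀ (hw ω) (hΘ ω) hΘ0.le (by linarith) fun i => hPle i (t + 1)
    rw [integral_add (integrable_const _) (((hC (t + 1)).integrable le_rfl).const_mul 4)] at h2
    simp only [integral_const, integral_const_mul, probReal_univ, one_smul,
      Nat.add_sub_cancel] at h1 h2
    linarith
  have hg2 : 0 < (r - v) ^ 2 := by positivity
  have hbad1 : μ.real {ω | ¬ ∀ t ≤ T + 1, |∑ j ∈ Finset.range t, inner ℝ (u i₀)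
      (noise A β s (w ω) (fun t i => X t i ω) j) / r ^ (j + 1)| ≤ 1 / 5} ≤ δ / 4 := by
    refine h.measureReal_walk_le hs (by simp) hr0 (T + 1) ?_
    have h1 := sum_inv_pow_sq_mul_le (fun t => (hP0 t).le) hg.le hr0 hPr
      (by positivity : 0 ≤ 16 * Θ) he0 hmom
    refine le_of_mul_le_mul_left ?_ hg2
    calc (r - v) ^ 2 * (25 * (η * ∑ j ∈ Finset.range (T + 1), (1 / r ^ (j + 1)) ^ 2 * e j))
        = 25 * η * ((r - v) ^ 2 * ∑ j ∈ Finset.range (T + 1), (1 / r ^ (j + 1)) ^ 2 * e j) := by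
          ring
      _ ≤ 25 * η * (16 * Θ * T) := by gcongr
      _ = Θ * (400 * (η * T)) := by ring
      _ ≤ 1 / 2 * (400 * (η * T)) := by gcongr
      _ ≤ (r - v) ^ 2 * (δ / 4) := by linarith
  have hbad2 : μ.real {ω | Θ * P (T + 1) ^ 2 / 32 <
      ∑ i, coordNoise A β s (w ω) (fun t i => X t i ω) (lam i) (u i) (T + 1) ^ 2} ≤ δ / 4 := by
    have hpos : 0 < Θ * P (T + 1) ^ 2 / 32 := by have := hP0 (T + 1); positivity
    refine measureReal_lt_le ((hC (T + 1)).integrable le_rfl)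
      (fun ω => Finset.sum_nonneg fun _ _ => sq_nonneg _) hpos ?_
    refine (h.integral_sum_coordNoise_sq_le (β := β) hs lam u hPle (T + 1)).trans ?_
    have h1 := sum_sq_mul_le (fun t => (hP0 t).le) hg.le hPP (by positivity : 0 ≤ 16 * Θ) he0 hmom
    refine le_of_mul_le_mul_left ?_ hg2
    simp only [Nat.add_sub_cancel]
    calc (r - v) ^ 2 * (η * ∑ j ∈ Finset.range (T + 1), P (T - j) ^ 2 * e j)
        = η * ((r - v) ^ 2 * ∑ j ∈ Finset.range (T + 1), P (T - j) ^ 2 * e j) := by ring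
      _ ≤ η * (16 * Θ * T * P (T + 1) ^ 2) := by gcongr
      _ = 2048 * (η * T) * (Θ * P (T + 1) ^ 2 / 128) := by ring
      _ ≤ δ * (r - v) ^ 2 * (Θ * P (T + 1) ^ 2 / 128) := by gcongr
      _ = (r - v) ^ 2 * (δ / 4 * (Θ * P (T + 1) ^ 2 / 32)) := by ring
  refine (measureReal_mono fun ω hω => ?_).trans
    (((measureReal_union_le _ _).trans (add_le_add hbad1 hbad2)).trans (by linarith))
  -- outside the two exceptional events the epoch succeeds
  by_contra hcon
  simp only [Set.mem_union, Set.mem_ofPred_eq, not_or, not_not, not_lt] at hcon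
  refine hω (inner_loop_good hA hs i₀ (hw ω) (hΘ ω) hP0 (fun i hi => hsmall i hi (T + 1)) ?_
    (fun t ht => ?_) hcon.2)
  · have h0 : 0 ≤ ((T + 1 : ℕ) + 1 : ℝ) * √β ^ (T + 1) := by positivity
    have h1 : 8 * (((T + 1 : ℕ) + 1 : ℝ) * √β ^ (T + 1)) ≤ P (T + 1) := by
      refine le_trans (le_of_eq ?_) hdet
      push_cast
      ring
    nlinarith
  · rw [hPeq]
    refine half_momentumPoly_le_abs (x := fun t => inner ℝ (u i₀)
      (rawLoop A β s (w ω) (fun t i => X t i ω) t).2)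
      (n := fun t => inner ℝ (u i₀) (noise A β s (w ω) (fun t i => X t i ω) t)) hv hr0 ?_ ?_ ?_
      hcon.1 ht
    · rw [rawLoop_succ_snd hs, inner_add_right, inner_sub_right, hA.inner_apply, hl]
      simp [rawLoop]
    · intro t
      rw [rawLoop_succ_snd hs, inner_add_right, inner_sub_right, hA.inner_apply, inner_smul_right,
        hl, hβ]
      rfl
    · have := hΘ ω
      simp only [rawLoop]
      linarith

end IsEpoch

/-! ### The choice of the parameters -/

/-- The prescribed epoch length and batch size meet the two requirements of `measureReal_bad_le`:
the noise level is small against the gap, and the oscillating modes are dominated. -/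
theorem epochLength_spec {d s T : ℕ} {l β σ c δ : ℝ} (hd : 1 ≤ d) (hβ : 0 ≤ β) (hl : 2 * √β < l)
    (hc0 : 0 < c) (hc : c ≤ Real.exp (-32)) (hδ0 : 0 < δ) (hδ1 : δ < 1)
    (hT : T = epochLength l β c δ) (hs : 1 ≤ s) (hsb : batchBound d l β σ c δ ≤ s) :
    ∃ (T' : ℕ) (r v : ℝ), T = T' + 1 ∧ 0 ≤ v ∧ v < r ∧ l = r + v ∧ β = r * v ∧
      2048 * (σ ^ 2 / s * T') ≤ δ * (r - v) ^ 2 ∧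
      8 * ((T' + 2) * √β ^ (T' + 1)) ≤ momentumPoly β l (T' + 1) := by
  have hb0 := Real.sqrt_nonneg β
  have hb2 := Real.sq_sqrt hβ
  set b := √β with hb
  have hD : 0 < l ^ 2 - 4 * β := by nlinarith
  set g := √(l ^ 2 - 4 * β) with hg
  have hg0 : 0 < g := Real.sqrt_pos.2 hD
  have hg2 : g ^ 2 = l ^ 2 - 4 * β := Real.sq_sqrt hD.le
  set L := Real.log (1 / (c * δ)) with hL
  have hcδ : 0 < c * δ := mul_pos hc0 hδ0
  have hL32 : 32 ≤ L := by
    rw [hL, Real.le_log_iff_exp_le (by positivity), le_one_div (Real.exp_pos _) hcδ]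
    rw [Real.exp_neg, ← one_div] at hc
    nlinarith
  have hc64 : 64 * c ≤ 1 := by
    have h1 := Real.add_one_le_exp (32 : ℝ)
    have h2 : (64 : ℝ) ≤ Real.exp 32 := by
      have h3 : Real.exp 32 = Real.exp 16 * Real.exp 16 := by rw [← Real.exp_add]; norm_num
      have h4 := Real.add_one_le_exp (16 : ℝ)
      rw [h3]
      nlinarith
    calc 64 * c ≤ Real.exp 32 * Real.exp (-32) := by gcongr
      _ = 1 := by rw [← Real.exp_add]; simp
  have hy0 : 0 ≤ b / g * L := by positivity
  -- `T` is at least `b / g * L`, and `T - 1` is at most that, also when the maximum is `1`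
  have hT1 : 1 ≤ T := by rw [hT]; exact le_max_left _ _
  have hTy : b / g * L ≤ T := by
    rw [hT]
    exact (Nat.le_ceil _).trans (by exact_mod_cast le_max_right _ _)
  obtain ⟨T', rfl⟩ : ∃ T', T = T' + 1 := ⟨T - 1, by omega⟩
  have hTy' : (T' : ℝ) ≤ b / g * L := by
    rcases max_choice 1 ⌈b / g * L⌉₊ with h | h
    · have h1 : T' + 1 = 1 := hT.trans h
      have : T' = 0 := by omega
      rw [this]; simpa using hy0
    · have h1 : T' + 1 = ⌈b / g * L⌉₊ := hT.trans h
      have h2 := Nat.ceil_lt_add_one hy0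
      rw [← h1] at h2
      push_cast at h2
      linarith
  have hgl : g ≤ l := Real.sqrt_le_iff.2 ⟨by linarith, by linarith⟩
  have hroot : β = (l + g) / 2 * ((l - g) / 2) := by nlinarith
  have hlr : l = (l + g) / 2 + (l - g) / 2 := by ring
  have hdiff : (l + g) / 2 - (l - g) / 2 = g := by ring
  have hv0 : 0 ≤ (l - g) / 2 := by linarith
  have hvr : (l - g) / 2 < (l + g) / 2 := by linarith
  refine ⟨T', (l + g) / 2, (l - g) / 2, rfl, hv0, hvr, hlr, hroot, ?_, ?_⟩
  · rw [hdiff]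
    have hs0 : (0 : ℝ) < s := by positivity
    have hpow : (l ^ 2 - 4 * β) ^ (3 / 2 : ℝ) = g ^ 3 := by
      rw [← hg2, ← Real.rpow_natCast, ← Real.rpow_natCast, ← Real.rpow_mul hg0.le]
      norm_num
    have hd1 : (1 : ℝ) ≤ √(d : ℝ) := Real.one_le_sqrt.2 (by exact_mod_cast hd)
    rw [batchBound, hpow, div_mul_eq_mul_div, div_le_iff₀ (by positivity)] at hsb
    have h1 : 32 * (b * σ ^ 2 * L) ≤ s * (c * g ^ 3 * δ) := by
      refine le_trans ?_ hsb
      have h2 : 0 ≤ 32 * (b * σ ^ 2 * L) := by positivity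
      calc 32 * (b * σ ^ 2 * L) ≤ √(d : ℝ) * (32 * (b * σ ^ 2 * L)) :=
            le_mul_of_one_le_left h2 hd1
        _ = _ := by ring
    have h3 : (T' : ℝ) * g ≤ b * L := by
      calc (T' : ℝ) * g ≤ b / g * L * g := by gcongr
        _ = b * L := by field_simp
    rw [div_mul_eq_mul_div, ← mul_div_assoc, div_le_iff₀ hs0]
    refine le_of_mul_le_mul_left ?_ hg0
    calc g * (2048 * (σ ^ 2 * T')) = 2048 * σ ^ 2 * (T' * g) := by ring
      _ ≤ 2048 * σ ^ 2 * (b * L) := by gcongr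
      _ = 64 * (32 * (b * σ ^ 2 * L)) := by ring
      _ ≤ 64 * (s * (c * g ^ 3 * δ)) := by gcongr
      _ = (64 * c) * (s * g ^ 3 * δ) := by ring
      _ ≤ 1 * (s * g ^ 3 * δ) := by gcongr
      _ = g * (δ * g ^ 2 * s) := by ring
  · have h1 := sub_mul_pow_le_momentumPoly (b := b) hv0 hvr.le (by rw [hb2, ← hroot]) T'
    rw [hdiff, ← hlr, ← hroot] at h1
    have h2 : 32 * b ≤ g * (T' + 1) := by
      push_cast at hTy
      calc 32 * b ≤ L * b := by gcongr
        _ = g * (b / g * L) := by field_simp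
        _ ≤ g * (T' + 1) := by gcongr
    have h3 : 32 * b * ((T' + 3) * b ^ T') ≤ g * (T' + 1) * ((T' + 3) * b ^ T') := by gcongr
    have h4 : 0 ≤ b ^ (T' + 1) := by positivity
    rw [pow_succ] at h4 ⊢
    nlinarith

/-! ### The sequence of epochs -/

section Epochs

variable {d : ℕ} {Ω : Type*} {m0 : MeasurableSpace Ω} {μ : Measure Ω}

/-- The σ-algebra generated by the samples drawn before `X k t i`, in lexicographic order. -/
noncomputable abbrev past (X : ℕ → ℕ → ℕ → Ω → Op d) (k t i : ℕ) : MeasurableSpace Ω :=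
  ⨆ j ∈ {j : ℕ × ℕ × ℕ | j.1 < k ∨ j.1 = k ∧ (j.2.1 < t ∨ j.2.1 = t ∧ j.2.2 < i)},
    MeasurableSpace.comap (X j.1 j.2.1 j.2.2) inferInstance

theorem past_mono (X : ℕ → ℕ → ℕ → Ω → Op d) {k t i k' t' i' : ℕ}
    (h : k' < k ∨ k' = k ∧ (t' < t ∨ t' = t ∧ i' ≤ i)) : past X k' t' i' ≤ past X k t i := by
  refine biSup_mono fun j hj => ?_
  simp only [Set.mem_ofPred_eq] at hj ⊢
  omega

theorem stronglyMeasurable_past (X : ℕ → ℕ → ℕ → Ω → Op d) {k t i k' t' i' : ℕ}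
    (h : k' < k ∨ k' = k ∧ (t' < t ∨ t' = t ∧ i' < i)) :
    StronglyMeasurable[past X k t i] (X k' t' i') := by
  refine Measurable.stronglyMeasurable (Measurable.of_comap_le ?_)
  exact le_biSup (fun j : ℕ × ℕ × ℕ => MeasurableSpace.comap (X j.1 j.2.1 j.2.2) inferInstance)
    (i := (k', t', i')) h

theorem IsIIDSamples.isEpoch {A : Op d} {r σ : ℝ} {X : ℕ → ℕ → ℕ → Ω → Op d}
    (h : IsIIDSamples μ A r σ X) (k : ℕ) {w : Ω → Vec d} (hw : BddMeas μ (past X k 0 0) w) :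
    IsEpoch μ (past X k) A σ (X k) w where
  le t i := iSup₂_le fun j _ => (h.measurable _ _ _).comap_le
  mono t i t' i' ht := past_mono X (by omega)
  adapted t i t' i' ht := by
    refine ⟨stronglyMeasurable_past X (by omega), r, ?_⟩
    exact (h.identDistrib k t' i').symm.ae_snd (p := fun L => ‖L‖ ≤ r)
      (measurableSet_le measurable_norm measurable_const) h.bounded
  indep t i := by
    have h1 := indep_iSup_of_disjoint (m := fun j : ℕ × ℕ × ℕ =>
      MeasurableSpace.comap (X j.1 j.2.1 j.2.2) inferInstance) (S := {(k, t, i)})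
      (T := {j : ℕ × ℕ × ℕ | j.1 < k ∨ j.1 = k ∧ (j.2.1 < t ∨ j.2.1 = t ∧ j.2.2 < i)})
      (fun j => (h.measurable _ _ _).comap_le) ((iIndepFun_iff_iIndep _ _ _).1 h.indep)
      (by simp)
    simpa only [Set.mem_singleton_iff, iSup_iSup_eq_left] using h1
  mean t i := by rw [(h.identDistrib k t i).integral_eq, h.mean]
  variance t i := by
    rw [← h.variance]
    exact ((h.identDistrib k t i).comp (u := fun L => ‖L - A‖ ^ 2) (by fun_prop)).integral_eq
  start := hw

theorem stronglyMeasurable_inner_loop {m : MeasurableSpace Ω} (A : Op d) (β : ℝ) (s : ℕ)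
    {w : Ω → Vec d} {X : ℕ → ℕ → Ω → Op d} (hw : StronglyMeasurable[m] w)
    (hX : ∀ t i, StronglyMeasurable[m] (X t i)) (t : ℕ) :
    StronglyMeasurable[m] (fun ω => (inner_loop A β s (w ω) (fun t i => X t i ω) t).1) ∧
      StronglyMeasurable[m] (fun ω => (inner_loop A β s (w ω) (fun t i => X t i ω) t).2) := by
  have happ : ∀ {L : Ω → Op d} {f : Ω → Vec d}, StronglyMeasurable[m] L →
      StronglyMeasurable[m] f → StronglyMeasurable[m] fun ω => L ω (f ω) := by
    intro L f hL hf
    have hc : Continuous fun p : Op d × Vec d => p.1 p.2 := by fun_prop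
    exact hc.comp_stronglyMeasurable (hL.prodMk hf)
  induction t with
  | zero => exact ⟨stronglyMeasurable_const, hw⟩
  | succ t ih =>
    obtain ⟨h1, h2⟩ := ih
    have hα : StronglyMeasurable[m] fun ω =>
        (inner ℝ (inner_loop A β s (w ω) (fun t i => X t i ω) t).2 (w ω) : ℝ) := h2.inner hw
    have hsum : StronglyMeasurable[m] fun ω => ∑ i ∈ Finset.range s, X t i ω
        ((inner_loop A β s (w ω) (fun t i => X t i ω) t).2 -
          (inner ℝ (inner_loop A β s (w ω) (fun t i => X t i ω) t).2 (w ω) : ℝ) • w ω) :=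
      Finset.stronglyMeasurable_fun_sum _ fun i _ => happ (hX t i) (h2.sub (hα.smul hw))
    have hnew := ((hsum.const_smul (1 / (s : ℝ))).add
      (hα.smul (happ (stronglyMeasurable_const (b := A)) hw))).sub (h1.const_smul β)
    have hn := hnew.norm.measurable.inv.stronglyMeasurable
    exact ⟨hn.smul h2, hn.smul hnew⟩

theorem stronglyMeasurable_anchor (A : Op d) (β : ℝ) (s T : ℕ) (w₀ : Vec d)
    (X : ℕ → ℕ → ℕ → Ω → Op d) (k : ℕ) :
    StronglyMeasurable[past X k 0 0] fun ω => anchor A β s T w₀ (fun k t i => X k t i ω) k := by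
  induction k with
  | zero => exact stronglyMeasurable_const
  | succ k ih =>
    exact (stronglyMeasurable_inner_loop A β s (ih.mono (past_mono X (by omega)))
      (fun t i => stronglyMeasurable_past X (by omega)) T).2

/-- After `k` epochs the error is at most `2⁻¹ ^ (k + 1)`, except with probability `k * δ / 2`. -/
theorem measureReal_anchor_bad_le [IsProbabilityMeasure μ] {hd : 2 ≤ d} {A : Op d} {lam : Fin d → ℝ}
    {u : OrthonormalBasis (Fin d) ℝ (Vec d)} (hA : IsPCATarget hd A lam u) {R σ : ℝ}
    {X : ℕ → ℕ → ℕ → Ω → Op d} (hX : IsIIDSamples μ A R σ X) {s : ℕ} (hs : 1 ≤ s) {β : ℝ}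
    {r v : ℝ} (hv : 0 ≤ v) (hr : v < r) (hl : lam ⟨0, by omega⟩ = r + v) (hβ : β = r * v)
    (hlam : lam ⟨1, by omega⟩ ≤ 2 * √β) {w₀ : Vec d} (hw₀ : ‖w₀‖ = 1)
    (hw₀' : 1 - (inner ℝ (u ⟨0, by omega⟩) w₀ : ℝ) ^ 2 ≤ 1 / 2) {T : ℕ} {δ : ℝ} (hδ : δ ≤ 1)
    (hκ : 2048 * (σ ^ 2 / s * T) ≤ δ * (r - v) ^ 2)
    (hdet : 8 * ((T + 2) * √β ^ (T + 1)) ≤ momentumPoly β (lam ⟨0, by omega⟩) (T + 1)) (k : ℕ) :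
    μ.real {ω | ¬ (‖anchor A β s (T + 1) w₀ (fun k t i => X k t i ω) k‖ = 1 ∧
      1 - (inner ℝ (u ⟨0, by omega⟩)
        (anchor A β s (T + 1) w₀ (fun k t i => X k t i ω) k) : ℝ) ^ 2 ≤ (1 / 2) ^ (k + 1))} ≤
      k * (δ / 2) := by
  classical
  induction k with
  | zero =>
    simp only [anchor, zero_add, pow_one, hw₀, hw₀']
    simp
  | succ k ih =>
    set a : Ω → Vec d := fun ω => anchor A β s (T + 1) w₀ (fun k t i => X k t i ω) k with ha
    set G : Set Ω := {ω | ‖a ω‖ = 1 ∧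
      1 - (inner ℝ (u ⟨0, by omega⟩) (a ω) : ℝ) ^ 2 ≤ (1 / 2) ^ (k + 1)} with hG
    have ham := stronglyMeasurable_anchor A β s (T + 1) w₀ X k
    have hem : Measurable[past X k 0 0] fun ω =>
        1 - (inner ℝ (u ⟨0, by omega⟩) (a ω) : ℝ) ^ 2 :=
      (stronglyMeasurable_const.sub
        ((stronglyMeasurable_const.inner (𝕜 := ℝ) ham).pow 2)).measurable
    have hGm : MeasurableSet[past X k 0 0] G :=
      (measurableSet_eq_fun ham.norm.measurable measurable_const).inter
        (measurableSet_le hem measurable_const)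
    -- on the bad event the anchor is replaced by the target, so that the epoch bound applies surely
    set w : Ω → Vec d := fun ω => if ω ∈ G then a ω else u ⟨0, by omega⟩ with hw
    have hw1 : ∀ ω, ‖w ω‖ = 1 := by
      intro ω
      by_cases hω : ω ∈ G
      · simp only [hw, if_pos hω]; exact hω.1
      · simp [hw, if_neg hω]
    have hwΘ : ∀ ω, 1 - (inner ℝ (u ⟨0, by omega⟩) (w ω) : ℝ) ^ 2 ≤ (1 / 2) ^ (k + 1) := by
      intro ω
      by_cases hω : ω ∈ G
      · simp only [hw, if_pos hω]; exact hω.2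
      · simp [hw, if_neg hω]
    have hwm : BddMeas μ (past X k 0 0) w :=
      ⟨StronglyMeasurable.ite hGm ham stronglyMeasurable_const, 1,
        ae_of_all _ fun ω => (hw1 ω).le⟩
    have hΘ1 : (1 / 2 : ℝ) ^ (k + 1) ≤ 1 / 2 := by
      rw [pow_succ]
      have : (1 / 2 : ℝ) ^ k ≤ 1 := pow_le_one₀ (by norm_num) (by norm_num)
      linarith
    have hbad := (hX.isEpoch k hwm).measureReal_bad_le hA hs hv hr hl hβ hlam hw1
      (by positivity) hΘ1 hwΘ hδ hκ hdet
    refine (measureReal_mono fun ω hω => ?_).trans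
      (((measureReal_union_le _ _).trans (add_le_add ih hbad)).trans
        (le_of_eq (by push_cast; ring)))
    by_cases hωG : ω ∈ G
    · right
      have hwa : w ω = a ω := if_pos hωG
      have e : (1 / 2 : ℝ) ^ (k + 1 + 1) = (1 / 2) ^ (k + 1) / 2 := by ring
      simp only [Set.mem_ofPred_eq, hwa]
      rw [← e]
      exact hω
    · left
      exact hωG

end Epochs

end VRPower

theorem mainTheorem1 :
    ∃ c₀ : ℝ, 0 < c₀ ∧ c₀ < 1 / 16 ∧ ∃ C : ℝ, 0 < C ∧
      ∀ ε : ℝ, 0 < ε → ε < 1 →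
      ∃ K : ℕ, (K : ℝ) ≤ C * Real.log (1 / ε) ∧
        ∀ (c : ℝ), 0 < c → c ≤ c₀ →
        ∀ (δ : ℝ), 0 < δ → δ < 1 →
        ∀ (d : ℕ) (hd : 2 ≤ d)
          (A : VRPower.Op d) (lam : Fin d → ℝ)
          (u : OrthonormalBasis (Fin d) ℝ (VRPower.Vec d)),
          VRPower.IsPCATarget hd A lam u →
        ∀ (Ω : Type*) [MeasurableSpace Ω] (μ : Measure Ω) [IsProbabilityMeasure μ]
          (r σ : ℝ) (X : ℕ → ℕ → ℕ → Ω → VRPower.Op d),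
          VRPower.IsIIDSamples μ A r σ X →
        ∀ (β : ℝ), 0 ≤ β →
          lam ⟨1, by omega⟩ ≤ 2 * √β → 2 * √β < lam ⟨0, by omega⟩ →
        ∀ (w₀ : VRPower.Vec d), ‖w₀‖ = 1 →
          1 - (inner ℝ (u ⟨0, by omega⟩) w₀) ^ 2 ≤ 1 / 2 →
        ∀ (T s : ℕ), T = VRPower.epochLength (lam ⟨0, by omega⟩) β c δ →
          1 ≤ s → VRPower.batchBound d (lam ⟨0, by omega⟩) β σ c δ ≤ (s : ℝ) →
          1 - Real.log (1 / ε) * δ ≤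
            μ.real {ω | 1 - (inner ℝ (u ⟨0, by omega⟩)
              (VRPower.anchor A β s T w₀ (fun k t i => X k t i ω) K)) ^ 2 ≤ ε} := by
  have hexp : Real.exp (-32) < 1 / 16 := by
    rw [Real.exp_neg, ← one_div]
    exact one_div_lt_one_div_of_lt (by norm_num)
      (by linarith [Real.add_one_le_exp (32 : ℝ)])
  -- `c ≤ exp (-32)` makes the logarithm in the epoch length at least `32`; each epoch halves the
  -- error, so about `log₂ (1 / ε)` epochs are needed, and `1 / log 2 ≤ 2`
  refine ⟨Real.exp (-32), Real.exp_pos _, hexp, 2, by norm_num, fun ε hε0 hε1 => ?_⟩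
  have hlog : 0 < Real.log (1 / ε) := Real.log_pos ((one_lt_div hε0).2 hε1)
  have hlog2 : 0 < Real.log 2 := Real.log_pos (by norm_num)
  have hhalf : 1 / 2 ≤ Real.log 2 := by linarith [Real.log_two_gt_d9]
  set K := ⌊Real.log (1 / ε) / Real.log 2⌋₊ with hK
  have hK2 : (K : ℝ) ≤ 2 * Real.log (1 / ε) := by
    refine (Nat.floor_le (by positivity)).trans ?_
    rw [div_le_iff₀ hlog2]
    nlinarith
  have hKε : (1 / 2 : ℝ) ^ (K + 1) ≤ ε := by
    have h1 : Real.log (1 / ε) ≤ (K + 1 : ℕ) * Real.log 2 := by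
      have := (Nat.lt_floor_add_one (Real.log (1 / ε) / Real.log 2)).le
      rw [div_le_iff₀ hlog2] at this
      exact_mod_cast this
    rw [← Real.log_pow, Real.log_le_log_iff (by positivity) (by positivity)] at h1
    rw [one_div_pow]
    exact (one_div_le (by positivity) hε0).2 h1
  refine ⟨K, hK2, ?_⟩
  intro c hc0 hc δ hδ0 hδ1 d hd A lam u hA Ω _ μ _ R σ X hX β hβ0 hlam hβl w₀ hw₀ hw₀' T s hT hs hsb
  obtain ⟨T', r, v, rfl, hv, hr, hl, hβ, hκ, hdet⟩ :=
    VRPower.epochLength_spec (by omega) hβ0 hβl hc0 hc hδ0 hδ1 hT hs hsb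
  have hbad := VRPower.measureReal_anchor_bad_le hA hX hs hv hr hl hβ hlam hw₀ hw₀' hδ1.le hκ hdet K
  set E := {ω | 1 - (inner ℝ (u ⟨0, by omega⟩)
    (VRPower.anchor A β s (T' + 1) w₀ (fun k t i => X k t i ω) K)) ^ 2 ≤ ε} with hE
  have h1 : 1 ≤ μ.real E + μ.real Eᶜ := by
    have := measureReal_union_le (μ := μ) E Eᶜ
    rwa [Set.union_compl_self, probReal_univ] at this
  have h2 : μ.real Eᶜ ≤ K * (δ / 2) := by
    refine le_trans (measureReal_mono ?_) hbad
    intro ω hω hgood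
    exact hω (hgood.2.trans hKε)
  have h3 : (K : ℝ) * (δ / 2) ≤ Real.log (1 / ε) * δ := by nlinarith
  linarith
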